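/- Theorem 5.2. There exist absolute constants $C,c>0$ such that the following holds. Let $(X_j)_{j\ge 1}$ be random variables on a probability space $(\Omega,\mathbf P)$ with $\mathbf E X_iX_j=\delta_{ij}$ for all $i,j\ge 1$, $\mathbf E X_j=0$ for all $j$, and $\sup_j \mathbf E|X_j|^3<\infty$. Let $R\ge 0$ be a random variable (possibly on another probability space) such that $$\frac1n\sum_{j=1}^n X_j^2\longrightarrow R^2\qquad (n\to\infty)$$ in the sense of weak convergence of distributions on the real line. Let $\Phi_R$ be the distribution function of $R\zeta$, where $\zeta$ is a standard normal random variable independent of $R$. For $1\le k\le n$ let $\mathcal G_{n,k}$ be the family of all $k$-element subsets of $\{1,\dots,n\}$, let $\mu_{n,k}$ be the normalized counting measure on $\mathcal G_{n,k}$, and for $\tau\in\mathcal G_{n,k}$ let $F_\tau$ be the distribution function of $S_\tau=k^{-1/2}\sum_{j\in\tau}X_j$. For distribution functions $F,G$ let $$L(F,G)=\inf\{\delta\ge 0:\ G(x-\delta)-\delta\le F(x)\le G(x+\delta)+\delta\ \text{ for all } x\in\mathbf R\}$$ be the Lévy distance. Then there are numbers $\varepsilon_{n,k}$, not depending on $\delta$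 or $\tau$, with $\varepsilon_{n,k}\to 0$ as $k\to\infty$ and $n/k\to\infty$, such that for all $1\le k\le n$ and every $\delta>0$, all $\tau\in\mathcal G_{n,k}$ except for a set of $\mu_{n,k}$-measure at most $Ck^{3/4}\exp(-ck\delta^8)$ satisfy $$L(F_\tau,\Phi_R)<\delta+\varepsilon_{n,k}.$$ -/

import Mathlib

open MeasureTheory ProbabilityTheory Filter Topology

/-- The distribution function `x ↦ P{Y ≤ x}` of a real random variable `Y`. -/
noncomputable def distFun {Ω : Type*} [MeasurableSpace Ω] (P : Measure Ω) (Y : Ω → ℝ) : ℝ → ℝ :=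
  fun x => P.real {ω | Y ω ≤ x}

/-- The Lévy distance: the infimum of all `δ ≥ 0` such that
`G (x - δ) - δ ≤ F x ≤ G (x + δ) + δ` for all real `x`. -/
noncomputable def levyDistance (F G : ℝ → ℝ) : ℝ :=
  sInf {δ : ℝ | 0 ≤ δ ∧ ∀ x : ℝ, G (x - δ) - δ ≤ F x ∧ F x ≤ G (x + δ) + δ}

/-- The family of all `k`-element sets of indices among the first `n` indices `0, …, n - 1`. -/
def indexSets (n k : ℕ) : Finset (Finset ℕ) :=
  (Finset.range n).powersetCard k

open Classical in
/-- The normalized counting measure on `indexSets n k`. -/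
noncomputable def sliceMeasure (n k : ℕ) (A : Set (Finset ℕ)) : ℝ :=
  (((indexSets n k).filter (fun τ => τ ∈ A)).card : ℝ) / ((indexSets n k).card : ℝ)

/-- The normalized sum `S_τ` of the `X i`, `i ∈ τ`, divided by the square root of the
cardinality of `τ`. -/
noncomputable def normalizedSum {Ω : Type*} (X : ℕ → Ω → ℝ) (τ : Finset ℕ) : Ω → ℝ :=
  fun ω => (∑ i ∈ τ, X i ω) / Real.sqrt (τ.card : ℝ)

/-- The distribution function of `R ζ`, where `ζ` is standard normal and independent of `R`:
both are realized on the product of the probability space of `R` with the standard Gaussian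
line, `ζ` being the second coordinate. -/
noncomputable def mixedNormalDistFun {Ω : Type*} [MeasurableSpace Ω] (P : Measure Ω)
    (R : Ω → ℝ) : ℝ → ℝ :=
  distFun (P.prod (gaussianReal 0 1)) (fun p : Ω × ℝ => R p.1 * p.2)

/-- The asymptotic range `1 ≪ k ≪ n` as a filter on pairs `(n, k)`:
`k → ∞` and `n / k → ∞`. -/
noncomputable def sparseRange : Filter (ℕ × ℕ) :=
  comap (fun p : ℕ × ℕ => p.2) atTop ⊓ comap (fun p : ℕ × ℕ => (p.1 : ℝ) / (p.2 : ℝ)) atTop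

/-! The uniform choice of a `k`-set is replaced by independent selection of each index `j < n` with
probability `p = k / n`. All `k`-sets have the same Bernoulli weight and together carry mass at
least `1 / (4√k)`, so an event on the slice costs at most a factor `4√k` over the product measure
(`sliceMeasure_le_bernoulliMean`).

Under the product measure, a modified logarithmic Sobolev inequality and the Herbst argument give
subgaussian tails for functions with small discrete gradient. They are applied to `b ↦ E v(S_b)`,
where `v` is a smooth step of width `δ`. Toggling `j` changes this by `E v'(S_b) X_j / √k` up to
`O(δ⁻² / k)`. Bessel's inequality for the orthonormal `X_j` sums the squares of the first terms to
`O(δ⁻² / k)`, independently of `n`; the weights of the toggles sum to `O(k)` once `|b| ≤ 3k`, which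
a cutoff enforces. The energy is thus `O(δ⁻⁴ / k)` (`bernoulliEnergy_cutoff_le`), and deviations of
order `δ` have probability at most `2 exp(-ckδ⁶)`. A grid of `O(δ⁻²)` steps controls the Lévy
distance from `F_τ` to the averaged distribution function (`sliceMeasure_levy_gt_le`).

That average has characteristic function `E ∏ (1 - p + p exp(itX_j / √k))`. It is close to `E exp(it
(√k / n) ∑ X_j) exp(-(t² / 2) n⁻¹ ∑ X_j²)`, and the phase disappears because `∑ X_j` has `L²` norm
`√n` and `k / n → 0`. The limit is `E exp(-t² R² / 2)`, the characteristic function of `Rζ`; the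
remaining Lévy distance goes into `ε` (`tendsto_levyDistance_bernoulliDistFun`). When `kδ⁸ ≥ 20`,
the factor `√k δ⁻²` is at most `k^(3/4)`; otherwise the asserted bound exceeds `1`. -/

/-- The probability of the set `b ⊆ s` when the elements of `s` are selected independently
with probability `p`. -/
noncomputable def bernoulliWeight (p : ℝ) (s b : Finset ℕ) : ℝ :=
  p ^ b.card * (1 - p) ^ (s \ b).card

/-- The expectation of `h` of a random subset of `s` whose elements are selected independently
with probability `p`. -/
noncomputable def bernoulliMean (p : ℝ) (s : Finset ℕ) (h : Finset ℕ → ℝ) : ℝ :=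
  ∑ b ∈ s.powerset, bernoulliWeight p s b * h b

/-! ### Modified logarithmic Sobolev inequality on the discrete cube. -/

section Bernoulli

lemma bernoulliWeight_nonneg {p : ℝ} (hp : 0 ≤ p) (hp1 : p ≤ 1) (s b : Finset ℕ) :
    0 ≤ bernoulliWeight p s b :=
  mul_nonneg (pow_nonneg hp _) (pow_nonneg (by linarith) _)

/-- Multiplying out the product makes one selection per index. It is used with `f = 1` for the total
mass, `f = 2` for a Chernoff bound and complex exponentials for characteristic functions, hence the
general algebra. -/
lemma sum_bernoulliWeight_mul_prod {𝕜 : Type*} [CommRing 𝕜] [Algebra ℝ 𝕜] (p : ℝ) (s : Finset ℕ)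
    (f : ℕ → 𝕜) :
    ∑ b ∈ s.powerset, algebraMap ℝ 𝕜 (bernoulliWeight p s b) * ∏ j ∈ b, f j
      = ∏ j ∈ s, (algebraMap ℝ 𝕜 p * f j + algebraMap ℝ 𝕜 (1 - p)) := by
  rw [Finset.prod_add]
  refine Finset.sum_congr rfl fun b _ => ?_
  rw [Finset.prod_mul_distrib, Finset.prod_const, Finset.prod_const, bernoulliWeight, map_mul,
    map_pow, map_pow]
  ring

lemma sum_bernoulliWeight (p : ℝ) (s : Finset ℕ) :
    ∑ b ∈ s.powerset, bernoulliWeight p s b = 1 := by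
  have := sum_bernoulliWeight_mul_prod (𝕜 := ℝ) p s (fun _ => 1)
  simpa using this

lemma bernoulliMean_empty (p : ℝ) (h : Finset ℕ → ℝ) : bernoulliMean p ∅ h = h ∅ := by
  simp [bernoulliMean, bernoulliWeight]

/-- Conditioning on the selection of `a`; this drives the tensorization by induction on `s`. -/
lemma bernoulliMean_insert (p : ℝ) {s : Finset ℕ} {a : ℕ} (ha : a ∉ s) (h : Finset ℕ → ℝ) :
    bernoulliMean p (insert a s) h
      = (1 - p) * bernoulliMean p s h + p * bernoulliMean p s (fun b => h (insert a b)) := by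
  unfold bernoulliMean
  rw [Finset.sum_powerset_insert ha, Finset.mul_sum, Finset.mul_sum]
  congr 1
  · refine Finset.sum_congr rfl fun b hb => ?_
    have hab : a ∉ b := fun h => ha (Finset.mem_powerset.1 hb h)
    rw [bernoulliWeight, bernoulliWeight, Finset.insert_sdiff_of_notMem _ hab,
      Finset.card_insert_of_notMem (by simp [ha])]
    ring
  · refine Finset.sum_congr rfl fun b hb => ?_
    have hab : a ∉ b := fun h => ha (Finset.mem_powerset.1 hb h)
    have : insert a s \ insert a b = s \ b := by
      ext x; simp only [Finset.mem_sdiff, Finset.mem_insert]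
      constructor
      · rintro ⟨h1 | h1, h2⟩ <;> tauto
      · rintro ⟨h1, h2⟩
        refine ⟨Or.inr h1, ?_⟩
        rintro (rfl | h3)
        · exact ha h1
        · exact h2 h3
    rw [bernoulliWeight, bernoulliWeight, this, Finset.card_insert_of_notMem hab]
    ring

lemma bernoulliMean_mono {p : ℝ} (hp : 0 ≤ p) (hp1 : p ≤ 1) {s : Finset ℕ} {f g : Finset ℕ → ℝ}
    (h : ∀ b ⊆ s, f b ≤ g b) : bernoulliMean p s f ≤ bernoulliMean p s g :=
  Finset.sum_le_sum fun b hb => mul_le_mul_of_nonneg_left (h b (Finset.mem_powerset.1 hb))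
    (bernoulliWeight_nonneg hp hp1 s b)

lemma bernoulliMean_congr {p : ℝ} {s : Finset ℕ} {f g : Finset ℕ → ℝ}
    (h : ∀ b ⊆ s, f b = g b) : bernoulliMean p s f = bernoulliMean p s g :=
  Finset.sum_congr rfl fun b hb => by rw [h b (Finset.mem_powerset.1 hb)]

lemma bernoulliMean_const (p : ℝ) (s : Finset ℕ) (c : ℝ) :
    bernoulliMean p s (fun _ => c) = c := by
  rw [bernoulliMean, ← Finset.sum_mul, sum_bernoulliWeight, one_mul]

lemma bernoulliMean_add (p : ℝ) (s : Finset ℕ) (f g : Finset ℕ → ℝ) :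
    bernoulliMean p s (fun b => f b + g b) = bernoulliMean p s f + bernoulliMean p s g := by
  simp [bernoulliMean, mul_add, Finset.sum_add_distrib]

lemma bernoulliMean_const_mul (p : ℝ) (s : Finset ℕ) (c : ℝ) (f : Finset ℕ → ℝ) :
    bernoulliMean p s (fun b => c * f b) = c * bernoulliMean p s f := by
  simp only [bernoulliMean, Finset.mul_sum]
  exact Finset.sum_congr rfl fun b _ => by ring

lemma bernoulliMean_exp_pos {p : ℝ} (hp : 0 ≤ p) (hp1 : p ≤ 1) (s : Finset ℕ)
    (g : Finset ℕ → ℝ) : 0 < bernoulliMean p s (fun b => Real.exp (g b)) := by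
  obtain ⟨b₀, -, hb₀⟩ := s.powerset.exists_min_image g ⟨∅, by simp⟩
  calc 0 < Real.exp (g b₀) := Real.exp_pos _
    _ = bernoulliMean p s (fun _ => Real.exp (g b₀)) := (bernoulliMean_const _ _ _).symm
    _ ≤ _ := bernoulliMean_mono hp hp1 fun b hb =>
      Real.exp_le_exp.2 (hb₀ b (Finset.mem_powerset.2 hb))

/-- The entropy of a two-point distribution is dominated by every linear functional that arises
as its tangent. -/
lemma two_point_entropy_ge {p x y x₀ y₀ : ℝ} (hp : 0 ≤ p) (hp1 : p ≤ 1) (hx : 0 < x) (hy : 0 < y)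
    (hx₀ : 0 < x₀) (hy₀ : 0 < y₀) :
    (1 - p) * x * (Real.log x₀ - Real.log ((1 - p) * x₀ + p * y₀))
        + p * y * (Real.log y₀ - Real.log ((1 - p) * x₀ + p * y₀))
      ≤ (1 - p) * (x * Real.log x) + p * (y * Real.log y)
        - ((1 - p) * x + p * y) * Real.log ((1 - p) * x + p * y) := by
  have pos : ∀ {u v : ℝ}, 0 < u → 0 < v → 0 < (1 - p) * u + p * v := by
    intro u v hu hv
    rcases eq_or_lt_of_le hp with rfl | h
    · simpa using hu
    · have := mul_pos h hv
      have := mul_nonneg (sub_nonneg.2 hp1) hu.le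
      linarith
  have hm := pos hx hy
  have hm₀ := pos hx₀ hy₀
  set m := (1 - p) * x + p * y with hmd
  set m₀ := (1 - p) * x₀ + p * y₀ with hm₀d
  -- This is `log z ≤ z - 1` at `z = u₀ m / (u m₀)`. Averaged with weights `1 - p` and `p`, the
  -- left-hand sides cancel.
  have key : ∀ {u u₀ : ℝ}, 0 < u → 0 < u₀ →
      u - u₀ * m / m₀ ≤ u * (Real.log u - Real.log u₀ + Real.log m₀ - Real.log m) := by
    intro u u₀ hu hu₀
    have h1 := Real.log_le_sub_one_of_pos (x := u₀ * m / (u * m₀)) (by positivity)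
    rw [Real.log_div (by positivity) (by positivity), Real.log_mul hu₀.ne' hm.ne',
      Real.log_mul hu.ne' hm₀.ne'] at h1
    have h2 : u * (u₀ * m / (u * m₀)) = u₀ * m / m₀ := by field_simp
    nlinarith [mul_le_mul_of_nonneg_left h1 hu.le]
  have h1 := mul_le_mul_of_nonneg_left (key hx hx₀) (sub_nonneg.2 hp1)
  have h2 := mul_le_mul_of_nonneg_left (key hy hy₀) hp
  have h3 : (1 - p) * (x - x₀ * m / m₀) + p * (y - y₀ * m / m₀) = 0 := by
    have : (1 - p) * (x - x₀ * m / m₀) + p * (y - y₀ * m / m₀)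
        = ((1 - p) * x + p * y) - ((1 - p) * x₀ + p * y₀) * m / m₀ := by ring
    rw [this, ← hmd, ← hm₀d]
    field_simp
    ring
  have h4 : m * Real.log m = (1 - p) * x * Real.log m + p * y * Real.log m := by rw [hmd]; ring
  rw [h4]
  linarith

lemma mul_sub_exp_le (a b : ℝ) :
    (a - b) * (Real.exp a - Real.exp b) ≤ (a - b) ^ 2 * (Real.exp a + Real.exp b) := by
  have key : ∀ a b : ℝ, b ≤ a →
      (a - b) * (Real.exp a - Real.exp b) ≤ (a - b) ^ 2 * (Real.exp a + Real.exp b) := by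
    intro a b hab
    have h1 : Real.exp a - Real.exp b ≤ (a - b) * Real.exp a := by
      have h := Real.add_one_le_exp (b - a)
      have h2 : Real.exp b = Real.exp a * Real.exp (b - a) := by rw [← Real.exp_add]; ring_nf
      nlinarith [Real.exp_pos a]
    calc (a - b) * (Real.exp a - Real.exp b) ≤ (a - b) * ((a - b) * Real.exp a) :=
          mul_le_mul_of_nonneg_left h1 (by linarith)
      _ ≤ _ := by nlinarith [Real.exp_pos b, sq_nonneg (a - b), mul_nonneg (sq_nonneg (a - b)) (Real.exp_pos b).le]
  rcases le_total b a with h | h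
  · exact key a b h
  · have := key b a h
    nlinarith

/-- By Jensen, `log m ≥ (1 - p) a + p b`. This bounds the entropy by the covariance `p (1 - p) (b -
a) (exp b - exp a)`, which `mul_sub_exp_le` turns into a squared gradient. -/
lemma two_point_entropy_exp_le {p : ℝ} (hp : 0 ≤ p) (hp1 : p ≤ 1) (a b : ℝ) :
    (1 - p) * (Real.exp a * a) + p * (Real.exp b * b)
        - ((1 - p) * Real.exp a + p * Real.exp b)
          * Real.log ((1 - p) * Real.exp a + p * Real.exp b)
      ≤ p * (1 - p) * ((b - a) ^ 2 * (Real.exp b + Real.exp a)) := by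
  set m := (1 - p) * Real.exp a + p * Real.exp b with hm
  have hj : Real.exp ((1 - p) * a + p * b) ≤ m :=
    convexOn_exp.2 (Set.mem_univ a) (Set.mem_univ b) (sub_nonneg.2 hp1) hp (by ring)
  have hmpos : 0 < m := (Real.exp_pos _).trans_le hj
  have hl : (1 - p) * a + p * b ≤ Real.log m := by
    rw [Real.le_log_iff_exp_le hmpos]; exact hj
  have h1 := mul_le_mul_of_nonneg_left hl hmpos.le
  have h2 := mul_le_mul_of_nonneg_left (mul_sub_exp_le b a)
    (mul_nonneg hp (sub_nonneg.2 hp1))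
  have h3 : (1 - p) * (Real.exp a * a) + p * (Real.exp b * b) - m * ((1 - p) * a + p * b)
      = p * (1 - p) * ((b - a) * (Real.exp b - Real.exp a)) := by rw [hm]; ring
  linarith

/-- The weighted squared length of the discrete gradient of `g` at `b`. -/
noncomputable def bernoulliEnergy (p : ℝ) (s : Finset ℕ) (g : Finset ℕ → ℝ) (b : Finset ℕ) : ℝ :=
  ∑ j ∈ s, (if j ∈ b then 1 - p else p) * (g (insert j b) - g (b.erase j)) ^ 2

lemma bernoulliEnergy_insert (p : ℝ) {s : Finset ℕ} {a : ℕ} (ha : a ∉ s) (g : Finset ℕ → ℝ)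
    (b : Finset ℕ) :
    bernoulliEnergy p (insert a s) g b
      = (if a ∈ b then 1 - p else p) * (g (insert a b) - g (b.erase a)) ^ 2
        + bernoulliEnergy p s g b := by
  rw [bernoulliEnergy, Finset.sum_insert ha, bernoulliEnergy]

lemma bernoulliEnergy_comp_insert (p : ℝ) {s : Finset ℕ} {a : ℕ} (ha : a ∉ s)
    (g : Finset ℕ → ℝ) (b : Finset ℕ) :
    bernoulliEnergy p s g (insert a b) = bernoulliEnergy p s (fun b => g (insert a b)) b := by
  refine Finset.sum_congr rfl fun j hj => ?_
  have hja : j ≠ a := fun h => ha (h ▸ hj)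
  rw [Finset.insert_comm, Finset.erase_insert_of_ne (Ne.symm hja)]
  simp [hja]

/-- The modified logarithmic Sobolev inequality for products of Bernoulli measures. -/
theorem bernoulli_log_sobolev {p : ℝ} (hp : 0 ≤ p) (hp1 : p ≤ 1) (s : Finset ℕ)
    (g : Finset ℕ → ℝ) :
    bernoulliMean p s (fun b => Real.exp (g b) * g b)
        - bernoulliMean p s (fun b => Real.exp (g b))
          * Real.log (bernoulliMean p s (fun b => Real.exp (g b)))
      ≤ bernoulliMean p s (fun b => Real.exp (g b) * bernoulliEnergy p s g b) := by
  induction s using Finset.induction_on generalizing g with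
  | empty => simp [bernoulliMean_empty, bernoulliEnergy]
  | insert a s ha ih =>
    have h0 := ih g
    have h1 := ih (fun b => g (insert a b))
    simp only [bernoulliMean_insert p ha]
    set A := bernoulliMean p s (fun b => Real.exp (g b)) with hA
    set B := bernoulliMean p s (fun b => Real.exp (g (insert a b))) with hB
    have hApos : 0 < A := bernoulliMean_exp_pos hp hp1 s g
    have hBpos : 0 < B := bernoulliMean_exp_pos hp hp1 s _
    set m := (1 - p) * A + p * B with hm
    have hnot : ∀ b ⊆ s, a ∉ b := fun b hb h => ha (hb h)
    have e0 : bernoulliMean p s (fun b => Real.exp (g b) * bernoulliEnergy p (insert a s) g b)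
        = bernoulliMean p s (fun b => p * (Real.exp (g b) * (g (insert a b) - g b) ^ 2))
          + bernoulliMean p s (fun b => Real.exp (g b) * bernoulliEnergy p s g b) := by
      rw [← bernoulliMean_add]
      refine bernoulliMean_congr fun b hb => ?_
      rw [bernoulliEnergy_insert p ha, if_neg (hnot b hb), Finset.erase_eq_of_notMem (hnot b hb)]
      ring
    have e1 : bernoulliMean p s (fun b => Real.exp (g (insert a b))
          * bernoulliEnergy p (insert a s) g (insert a b))
        = bernoulliMean p s
            (fun b => (1 - p) * (Real.exp (g (insert a b)) * (g (insert a b) - g b) ^ 2))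
          + bernoulliMean p s (fun b => Real.exp (g (insert a b))
            * bernoulliEnergy p s (fun b => g (insert a b)) b) := by
      rw [← bernoulliMean_add]
      refine bernoulliMean_congr fun b hb => ?_
      rw [bernoulliEnergy_insert p ha, if_pos (Finset.mem_insert_self a b), Finset.insert_idem,
        Finset.erase_insert (hnot b hb), bernoulliEnergy_comp_insert p ha]
      ring
    -- Convexity of two-point entropy: the tangent functional at `(A, B)` is evaluated at `(exp (g
    -- b), exp (g (insert a b)))` and averaged over `b`, which reproduces the entropy of `(A, B)`
    -- exactly.
    have key : (1 - p) * A * (Real.log A - Real.log m) + p * B * (Real.log B - Real.log m)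
        ≤ bernoulliMean p s (fun b => p * (1 - p) * ((g (insert a b) - g b) ^ 2
          * (Real.exp (g (insert a b)) + Real.exp (g b)))) := by
      have : (1 - p) * A * (Real.log A - Real.log m) + p * B * (Real.log B - Real.log m)
          = bernoulliMean p s (fun b => (1 - p) * (Real.log A - Real.log m) * Real.exp (g b)
            + p * (Real.log B - Real.log m) * Real.exp (g (insert a b))) := by
        rw [bernoulliMean_add, bernoulliMean_const_mul, bernoulliMean_const_mul, ← hA, ← hB]
        ring
      rw [this]
      refine bernoulliMean_mono hp hp1 fun b _ => ?_
      refine le_trans ?_ (two_point_entropy_exp_le hp hp1 (g b) (g (insert a b)))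
      have := two_point_entropy_ge hp hp1 (Real.exp_pos (g b)) (Real.exp_pos (g (insert a b)))
        hApos hBpos
      rw [Real.log_exp, Real.log_exp] at this
      refine le_trans (le_of_eq ?_) this
      rw [← hm]
      ring
    have e2 : bernoulliMean p s (fun b => p * (1 - p) * ((g (insert a b) - g b) ^ 2
          * (Real.exp (g (insert a b)) + Real.exp (g b))))
        = (1 - p) * bernoulliMean p s
            (fun b => p * (Real.exp (g b) * (g (insert a b) - g b) ^ 2))
          + p * bernoulliMean p s
            (fun b => (1 - p) * (Real.exp (g (insert a b)) * (g (insert a b) - g b) ^ 2)) := by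
      rw [← bernoulliMean_const_mul, ← bernoulliMean_const_mul, ← bernoulliMean_add]
      exact bernoulliMean_congr fun b _ => by ring
    rw [e0, e1]
    rw [e2] at key
    have h0' := mul_le_mul_of_nonneg_left h0 (sub_nonneg.2 hp1)
    have h1' := mul_le_mul_of_nonneg_left h1 hp
    have e3 : m * Real.log m = (1 - p) * A * Real.log m + p * B * Real.log m := by
      rw [hm]; ring
    rw [e3]
    linarith

end Bernoulli

/-! ### Concentration for independent selection and transfer to the slice. -/

section Concentration

lemma bernoulliEnergy_const_mul (p c : ℝ) (s : Finset ℕ) (h : Finset ℕ → ℝ) (b : Finset ℕ) :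
    bernoulliEnergy p s (fun b => c * h b) b = c ^ 2 * bernoulliEnergy p s h b := by
  simp only [bernoulliEnergy, Finset.mul_sum]
  exact Finset.sum_congr rfl fun j _ => by ring

lemma hasDerivAt_bernoulliMean_exp (p : ℝ) (s : Finset ℕ) (h : Finset ℕ → ℝ) (t : ℝ) :
    HasDerivAt (fun t => bernoulliMean p s (fun b => Real.exp (t * h b)))
      (bernoulliMean p s (fun b => Real.exp (t * h b) * h b)) t := by
  refine HasDerivAt.fun_sum fun b _ => HasDerivAt.const_mul _ ?_
  have := ((hasDerivAt_id t).mul_const (h b)).exp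
  simpa using this

/-- The Herbst argument: a bound for the gradient yields a subgaussian Laplace transform. -/
theorem bernoulliMean_exp_le {p : ℝ} (hp : 0 ≤ p) (hp1 : p ≤ 1) {s : Finset ℕ}
    {h : Finset ℕ → ℝ} {V : ℝ} (hV : ∀ b ⊆ s, bernoulliEnergy p s h b ≤ V) {t : ℝ} (ht : 0 < t) :
    bernoulliMean p s (fun b => Real.exp (t * h b))
      ≤ Real.exp (t * bernoulliMean p s h + V * t ^ 2) := by
  set M : ℝ → ℝ := fun t => bernoulliMean p s (fun b => Real.exp (t * h b)) with hM
  set M' : ℝ → ℝ := fun t => bernoulliMean p s (fun b => Real.exp (t * h b) * h b) with hM'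
  have hMpos : ∀ t, 0 < M t := fun t => bernoulliMean_exp_pos hp hp1 s _
  have hder : ∀ t, HasDerivAt M (M' t) t := hasDerivAt_bernoulliMean_exp p s h
  have hlog : ∀ t, HasDerivAt (fun t => Real.log (M t)) (M' t / M t) t :=
    fun t => (hder t).log (hMpos t).ne'
  have hls : ∀ t, t * M' t - M t * Real.log (M t) ≤ t ^ 2 * V * M t := by
    intro t
    have h1 := bernoulli_log_sobolev hp hp1 s (fun b => t * h b)
    have h2 : bernoulliMean p s (fun b => Real.exp (t * h b) * (t * h b)) = t * M' t := by
      rw [hM', ← bernoulliMean_const_mul]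
      exact bernoulliMean_congr fun b _ => by ring
    have h3 : bernoulliMean p s (fun b => Real.exp (t * h b)
        * bernoulliEnergy p s (fun b => t * h b) b) ≤ t ^ 2 * V * M t := by
      rw [hM, ← bernoulliMean_const_mul]
      refine bernoulliMean_mono hp hp1 fun b hb => ?_
      rw [bernoulliEnergy_const_mul]
      have := mul_le_mul_of_nonneg_left (hV b hb)
        (mul_nonneg (sq_nonneg t) (Real.exp_pos (t * h b)).le)
      linarith
    rw [h2] at h1
    exact h1.trans h3
  -- Since `φ' = (t M' - M log M) / (t² M) - V`, the logarithmic Sobolev bound says precisely that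
  -- `φ` decreases; its limit at `0+` is the mean of `h`.
  set φ : ℝ → ℝ := fun t => Real.log (M t) / t - V * t with hφ
  have hφd : ∀ t, 0 < t →
      HasDerivAt φ ((M' t / M t * t - Real.log (M t) * 1) / t ^ 2 - V * 1) t := fun t ht =>
    ((hlog t).div (hasDerivAt_id t) ht.ne').sub ((hasDerivAt_id t).const_mul V)
  have hanti : AntitoneOn φ (Set.Ioi 0) := by
    refine antitoneOn_of_deriv_nonpos (convex_Ioi 0)
      (fun t ht => (hφd t ht).continuousAt.continuousWithinAt)
      (fun t ht => (hφd t (by simpa using ht)).differentiableAt.differentiableWithinAt) ?_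
    intro t ht
    rw [interior_Ioi] at ht
    have ht : 0 < t := ht
    rw [(hφd t ht).deriv, sub_nonpos, mul_one, mul_one, div_le_iff₀ (by positivity)]
    have h1 := hls t
    have h2 : M' t / M t * t - Real.log (M t) = (t * M' t - M t * Real.log (M t)) / M t := by
      have := (hMpos t).ne'
      field_simp
    rw [h2, div_le_iff₀ (hMpos t)]
    linarith
  have hM0 : M 0 = 1 := by simp [hM, bernoulliMean_const]
  have hM'0 : M' 0 = bernoulliMean p s h := by simp [hM']
  have hlim : Tendsto φ (𝓝[>] 0) (𝓝 (bernoulliMean p s h)) := by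
    have h1 := (hlog 0).tendsto_slope_zero_right
    have h2 : Tendsto (fun t : ℝ => V * t) (𝓝[>] 0) (𝓝 0) := by
      have : Tendsto (fun t : ℝ => V * t) (𝓝 0) (𝓝 (V * 0)) := (continuous_const_mul V).tendsto 0
      rw [mul_zero] at this
      exact this.mono_left nhdsWithin_le_nhds
    have h3 := h1.sub h2
    rw [hM0, hM'0, div_one, sub_zero] at h3
    refine h3.congr fun t => ?_
    simp only [hφ, zero_add, Real.log_one, sub_zero, smul_eq_mul]
    ring
  have hle : φ t ≤ bernoulliMean p s h := by
    refine ge_of_tendsto hlim ?_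
    filter_upwards [Ioo_mem_nhdsGT ht] with u hu
    exact hanti hu.1 ht hu.2.le
  have : Real.log (M t) ≤ t * bernoulliMean p s h + V * t ^ 2 := by
    simp only [hφ] at hle
    have := mul_le_mul_of_nonneg_left hle ht.le
    have e : t * (Real.log (M t) / t - V * t) = Real.log (M t) - V * t ^ 2 := by
      field_simp
    linarith
  rwa [Real.log_le_iff_le_exp (hMpos t)] at this

open Classical in
lemma bernoulliMean_upper_tail_le {p : ℝ} (hp : 0 ≤ p) (hp1 : p ≤ 1) {s : Finset ℕ}
    {h : Finset ℕ → ℝ} {V : ℝ} (hVpos : 0 < V) (hV : ∀ b ⊆ s, bernoulliEnergy p s h b ≤ V)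
    {r : ℝ} (hr : 0 < r) :
    bernoulliMean p s (fun b => if r ≤ h b - bernoulliMean p s h then 1 else 0)
      ≤ Real.exp (-(r ^ 2 / (4 * V))) := by
  set a := bernoulliMean p s h with ha
  -- The minimizer of the Chernoff exponent `V t² - r t`.
  set t := r / (2 * V) with htd
  have ht : 0 < t := by positivity
  calc bernoulliMean p s (fun b => if r ≤ h b - a then 1 else 0)
      ≤ bernoulliMean p s (fun b => Real.exp (-(t * (a + r))) * Real.exp (t * h b)) := by
        refine bernoulliMean_mono hp hp1 fun b _ => ?_
        rw [← Real.exp_add]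
        split_ifs with hb
        · rw [Real.one_le_exp_iff]
          have := mul_le_mul_of_nonneg_left hb ht.le
          linarith
        · positivity
    _ ≤ Real.exp (-(t * (a + r))) * Real.exp (t * a + V * t ^ 2) := by
        rw [bernoulliMean_const_mul]
        exact mul_le_mul_of_nonneg_left (bernoulliMean_exp_le hp hp1 hV ht) (Real.exp_pos _).le
    _ = Real.exp (-(r ^ 2 / (4 * V))) := by
        rw [← Real.exp_add, htd]
        congr 1
        field_simp
        ring

open Classical in
/-- Concentration of functions with bounded discrete gradient under a product of Bernoulli
measures. -/
theorem bernoulliMean_tail_le {p : ℝ} (hp : 0 ≤ p) (hp1 : p ≤ 1) {s : Finset ℕ}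
    {h : Finset ℕ → ℝ} {V : ℝ} (hVpos : 0 < V) (hV : ∀ b ⊆ s, bernoulliEnergy p s h b ≤ V)
    {r : ℝ} (hr : 0 < r) :
    bernoulliMean p s (fun b => if r ≤ |h b - bernoulliMean p s h| then 1 else 0)
      ≤ 2 * Real.exp (-(r ^ 2 / (4 * V))) := by
  have h1 := bernoulliMean_upper_tail_le hp hp1 hVpos hV hr
  have hV' : ∀ b ⊆ s, bernoulliEnergy p s (fun b => -1 * h b) b ≤ V := fun b hb => by
    rw [bernoulliEnergy_const_mul]
    simpa using hV b hb
  have h2 := bernoulliMean_upper_tail_le hp hp1 hVpos hV' hr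
  rw [bernoulliMean_const_mul] at h2
  rw [two_mul]
  refine le_trans ?_ (add_le_add h1 h2)
  rw [← bernoulliMean_add]
  refine bernoulliMean_mono hp hp1 fun b _ => ?_
  by_cases c1 : r ≤ |h b - bernoulliMean p s h|
  · rw [if_pos c1]
    rcases le_abs.1 c1 with c2 | c2
    · rw [if_pos c2]
      split_ifs <;> norm_num
    · rw [if_pos (show r ≤ -1 * h b - -1 * bernoulliMean p s h by linarith)]
      split_ifs <;> norm_num
  · rw [if_neg c1]
    split_ifs <;> norm_num

/-- Markov's inequality for `2 ^ |b|`, whose mean is `(1 + p) ^ n ≤ e ^ k`, against the threshold `4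
^ k`. It bounds the cost of the cardinality cutoff. -/
lemma bernoulliMean_card_gt_le {p : ℝ} (hp : 0 ≤ p) (hp1 : p ≤ 1) {n k : ℕ}
    (hk : p * n = k) {g : Finset ℕ → ℝ} (hg1 : ∀ b, g b ≤ 1)
    (hg : ∀ b, b.card ≤ 2 * k → g b ≤ 0) :
    bernoulliMean p (Finset.range n) g ≤ (Real.exp 1 / 4) ^ k := by
  have h1 := sum_bernoulliWeight_mul_prod (𝕜 := ℝ) p (Finset.range n) (fun _ => 2)
  simp only [Finset.prod_const, Finset.card_range, Algebra.algebraMap_self, RingHom.id_apply] at h1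
  calc bernoulliMean p (Finset.range n) g
      ≤ bernoulliMean p (Finset.range n) (fun b => (1 / 4) ^ k * 2 ^ b.card) := by
        refine bernoulliMean_mono hp hp1 fun b _ => ?_
        rcases le_or_gt b.card (2 * k) with h | h
        · exact (hg b h).trans (by positivity)
        · refine (hg1 b).trans ?_
          calc (1 : ℝ) = (1 / 4) ^ k * 2 ^ (2 * k) := by
                rw [pow_mul, ← mul_pow]; norm_num
            _ ≤ _ := by
                gcongr
                norm_num
    _ = (1 / 4) ^ k * (p * 2 + (1 - p)) ^ n := by
        rw [bernoulliMean_const_mul, ← h1]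
        rfl
    _ ≤ (1 / 4) ^ k * Real.exp p ^ n := by
        gcongr
        have := Real.add_one_le_exp p
        linarith
    _ = (Real.exp 1 / 4) ^ k := by
        rw [← Real.exp_nat_mul, mul_comm (n : ℝ), hk, ← Real.exp_one_pow k, ← mul_pow]
        congr 1
        ring

/-- The Stirling sequence decreases, so it is bounded by its value `e / √2` at `1`. -/
lemma factorial_le_stirling {n : ℕ} (hn : 1 ≤ n) :
    (n.factorial : ℝ) ≤ Real.exp 1 * √n * (n / Real.exp 1) ^ n := by
  obtain ⟨m, rfl⟩ := Nat.exists_eq_add_of_le' hn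
  have h := Stirling.stirlingSeq'_antitone (Nat.zero_le m)
  simp only [Function.comp, Nat.succ_eq_add_one, zero_add, Stirling.stirlingSeq_one] at h
  rw [Stirling.stirlingSeq, div_le_div_iff₀ (by positivity) (by positivity)] at h
  rw [Real.sqrt_mul (by norm_num)] at h
  have h2 : (0 : ℝ) < √2 := by positivity
  refine le_of_mul_le_mul_right (h.trans (le_of_eq ?_)) h2
  ring

/-- Two-sided Stirling bounds for the central binomial probability; the constants fit because `2π ≥
4` and `e² ≤ 8`. -/
lemma bernoulliWeight_slice_ge {n k : ℕ} (hk : 1 ≤ k) (hkn : k ≤ n) :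
    1 ≤ 4 * √k * ((n.choose k : ℝ) * ((k / n : ℝ) ^ k * (1 - k / n : ℝ) ^ (n - k))) := by
  have hk0 : (0 : ℝ) < k := by exact_mod_cast hk
  have hsk : (1 : ℝ) ≤ √k := Real.one_le_sqrt.2 (by exact_mod_cast hk)
  rcases hkn.eq_or_lt with rfl | hlt
  · simp only [Nat.choose_self, Nat.cast_one, Nat.sub_self, pow_zero, mul_one, div_self hk0.ne',
      one_pow]
    linarith
  obtain ⟨m, rfl⟩ := Nat.exists_eq_add_of_le hkn
  have hm : 1 ≤ m := by omega
  have hm0 : (0 : ℝ) < m := by exact_mod_cast hm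
  set e := Real.exp 1 with he
  have he0 : 0 < e := Real.exp_pos 1
  have he3 : e < 2.7182818286 := Real.exp_one_lt_d9
  have hn0 : (0 : ℝ) < ((k + m : ℕ) : ℝ) := by positivity
  have hchoose : ((k + m).choose k : ℝ) = ((k + m).factorial : ℝ)
      / ((k.factorial : ℝ) * (m.factorial : ℝ)) := by
    rw [Nat.cast_choose ℝ hkn, Nat.add_sub_cancel_left]
  have hone : (1 - (k : ℝ) / ((k + m : ℕ) : ℝ)) = m / ((k + m : ℕ) : ℝ) := by
    rw [eq_div_iff hn0.ne', sub_mul, div_mul_cancel₀ _ hn0.ne']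
    push_cast; ring
  rw [hone, hchoose, Nat.add_sub_cancel_left]
  have h1 := factorial_le_stirling hk
  have h2 := factorial_le_stirling hm
  have h3 := Stirling.le_factorial_stirling (k + m)
  rw [← he] at h1 h2 h3
  have hmn : √(m : ℝ) ≤ √((k + m : ℕ) : ℝ) := Real.sqrt_le_sqrt (by push_cast; linarith)
  have h4 : 2 * √(m : ℝ) ≤ √(2 * Real.pi * ((k + m : ℕ) : ℝ)) := by
    rw [Real.sqrt_mul (by positivity)]
    refine mul_le_mul ?_ hmn (by positivity) (by positivity)
    rw [Real.le_sqrt (by norm_num) (by positivity)]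
    nlinarith [Real.pi_gt_three]
  have h5 : (k.factorial : ℝ) * (m.factorial : ℝ)
      ≤ (e * √k * (k / e) ^ k) * (e * √m * (m / e) ^ m) := by gcongr
  have h6 : 2 * √m * (((k + m : ℕ) : ℝ) / e) ^ (k + m) ≤ ((k + m).factorial : ℝ) :=
    le_trans (by gcongr) h3
  have hkm : (0 : ℝ) < (k.factorial : ℝ) * (m.factorial : ℝ) := by positivity
  have h7 : 4 * √k * (((k + m).factorial : ℝ) / ((k.factorial : ℝ) * (m.factorial : ℝ))
      * ((k / ((k + m : ℕ) : ℝ)) ^ k * (m / ((k + m : ℕ) : ℝ)) ^ m))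
      = (4 * √k * (((k + m).factorial : ℝ)
        * ((k / ((k + m : ℕ) : ℝ)) ^ k * (m / ((k + m : ℕ) : ℝ)) ^ m)))
        / ((k.factorial : ℝ) * (m.factorial : ℝ)) := by ring
  rw [h7, le_div_iff₀ hkm, one_mul]
  refine h5.trans ?_
  have h8 : 4 * √k * ((2 * √m * (((k + m : ℕ) : ℝ) / e) ^ (k + m))
      * ((k / ((k + m : ℕ) : ℝ)) ^ k * (m / ((k + m : ℕ) : ℝ)) ^ m))
      = 8 * (√k * √m * ((k / e) ^ k * (m / e) ^ m)) := by
    rw [pow_add, div_pow, div_pow, div_pow, div_pow, div_pow, div_pow]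
    field_simp
    ring
  refine le_trans ?_ (mul_le_mul_of_nonneg_left
    (mul_le_mul_of_nonneg_right h6 (by positivity)) (by positivity))
  rw [h8]
  have h9 : e * √k * (k / e) ^ k * (e * √m * (m / e) ^ m)
      = e ^ 2 * (√k * √m * ((k / e) ^ k * (m / e) ^ m)) := by ring
  rw [h9]
  refine mul_le_mul_of_nonneg_right ?_ (by positivity)
  nlinarith

open Classical in
lemma sliceMeasure_le_bernoulliMean {n k : ℕ} (hk : 1 ≤ k) (hkn : k ≤ n) (A : Set (Finset ℕ)) :
    sliceMeasure n k A
      ≤ 4 * √k * bernoulliMean (k / n) (Finset.range n) (fun b => if b ∈ A then 1 else 0) := by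
  have hn0 : (0 : ℝ) < n := by exact_mod_cast (by omega : 0 < n)
  set w : ℝ := (k / n : ℝ) ^ k * (1 - k / n : ℝ) ^ (n - k) with hw
  have hge := bernoulliWeight_slice_ge hk hkn
  rw [← hw] at hge
  have hcard : (indexSets n k).card = n.choose k := by simp [indexSets]
  have hN : (0 : ℝ) < n.choose k := by exact_mod_cast Nat.choose_pos hkn
  have hp1 : (k / n : ℝ) ≤ 1 := div_le_one_of_le₀ (by exact_mod_cast hkn) hn0.le
  have hmean : (((indexSets n k).filter (fun τ => τ ∈ A)).card : ℝ) * w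
      ≤ bernoulliMean (k / n) (Finset.range n) (fun b => if b ∈ A then 1 else 0) := by
    rw [← nsmul_eq_mul, ← Finset.sum_const]
    refine le_trans (le_of_eq ?_) (Finset.sum_le_sum_of_subset_of_nonneg
      (s := (indexSets n k).filter (fun τ => τ ∈ A)) ?_ ?_)
    · refine Finset.sum_congr rfl fun b hb => ?_
      obtain ⟨hb1, hb2⟩ := Finset.mem_filter.1 hb
      obtain ⟨hb3, hb4⟩ := Finset.mem_powersetCard.1 hb1
      simp only [if_pos hb2]
      rw [mul_one, bernoulliWeight, hb4, Finset.card_sdiff_of_subset hb3, hb4,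
        Finset.card_range]
    · intro b hb
      exact Finset.mem_powerset.2 (Finset.mem_powersetCard.1 (Finset.mem_filter.1 hb).1).1
    · intro b _ _
      have := bernoulliWeight_nonneg (by positivity) hp1 (Finset.range n) b
      dsimp only
      split_ifs <;> simp [this]
  rw [sliceMeasure, hcard, div_le_iff₀ hN]
  set F := (((indexSets n k).filter (fun τ => τ ∈ A)).card : ℝ) with hF
  have hF0 : 0 ≤ F := Nat.cast_nonneg _
  calc F = F * 1 := (mul_one F).symm
    _ ≤ F * (4 * √k * (n.choose k * w)) := mul_le_mul_of_nonneg_left hge hF0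
    _ = 4 * √k * (F * w) * n.choose k := by ring
    _ ≤ _ := by gcongr

end Concentration

/-! ### A piecewise quadratic step with quadratic Taylor remainder. -/

section SmoothStep

/-- A continuously differentiable step, equal to `0` on `(-∞, 0]` and to `1` on `[1, ∞)`. -/
noncomputable def smoothStep (t : ℝ) : ℝ :=
  2 * max t 0 ^ 2 - 4 * max (t - 1 / 2) 0 ^ 2 + 2 * max (t - 1) 0 ^ 2

/-- The derivative of `smoothStep`. -/
noncomputable def smoothStepDeriv (t : ℝ) : ℝ :=
  4 * max t 0 - 8 * max (t - 1 / 2) 0 + 4 * max (t - 1) 0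

lemma smoothStep_of_nonpos {t : ℝ} (ht : t ≤ 0) : smoothStep t = 0 := by
  rw [smoothStep, max_eq_right ht, max_eq_right (by linarith), max_eq_right (by linarith)]
  norm_num

lemma smoothStep_of_one_le {t : ℝ} (ht : 1 ≤ t) : smoothStep t = 1 := by
  rw [smoothStep, max_eq_left (by linarith), max_eq_left (by linarith), max_eq_left (by linarith)]
  ring

lemma smoothStep_mem_Icc (t : ℝ) : smoothStep t ∈ Set.Icc (0 : ℝ) 1 := by
  rcases le_total t 0 with h0 | h0
  · rw [smoothStep_of_nonpos h0]; simp
  rcases le_total 1 t with h1 | h1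
  · rw [smoothStep_of_one_le h1]; simp
  rw [smoothStep, max_eq_left h0, max_eq_right (by linarith : t - 1 ≤ 0)]
  rcases le_total t (1 / 2) with h | h
  · rw [max_eq_right (by linarith)]
    constructor <;> nlinarith
  · rw [max_eq_left (by linarith)]
    constructor <;> nlinarith

lemma abs_smoothStepDeriv_le (t : ℝ) : |smoothStepDeriv t| ≤ 2 := by
  rw [smoothStepDeriv, abs_le]
  rcases le_total t 0 with h0 | h0 <;> rcases le_total t (1 / 2) with h1 | h1 <;>
    rcases le_total t 1 with h2 | h2 <;>
    simp only [h0, h1, h2, max_eq_left, max_eq_right, sub_nonneg, sub_nonpos] <;>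
    constructor <;> linarith

lemma sq_max_taylor (t h : ℝ) :
    0 ≤ max (t + h) 0 ^ 2 - max t 0 ^ 2 - 2 * max t 0 * h ∧
      max (t + h) 0 ^ 2 - max t 0 ^ 2 - 2 * max t 0 * h ≤ h ^ 2 := by
  rcases le_total t 0 with h0 | h0 <;> rcases le_total (t + h) 0 with h1 | h1 <;>
    simp only [h0, h1, max_eq_left, max_eq_right] <;> constructor <;>
      nlinarith [sq_nonneg (t + h), sq_nonneg h]

/-- Each squared positive part has remainder in `[0, h²]`; the coefficients `2, -4, 2` have positive
and negative parts summing to `4` each. -/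
lemma abs_smoothStep_taylor_le (t h : ℝ) :
    |smoothStep (t + h) - smoothStep t - smoothStepDeriv t * h| ≤ 4 * h ^ 2 := by
  obtain ⟨a1, a2⟩ := sq_max_taylor t h
  obtain ⟨b1, b2⟩ := sq_max_taylor (t - 1 / 2) h
  obtain ⟨c1, c2⟩ := sq_max_taylor (t - 1) h
  rw [sub_add_eq_add_sub] at b1 b2 c1 c2
  rw [smoothStep, smoothStep, smoothStepDeriv, abs_le]
  constructor <;> linarith

lemma continuous_smoothStep : Continuous smoothStep := by
  unfold smoothStep; fun_prop

lemma continuous_smoothStepDeriv : Continuous smoothStepDeriv := by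
  unfold smoothStepDeriv; fun_prop

end SmoothStep

/-! ### Discrete gradient of the functional `E v(S_b)`. -/

section Energy

/-- The sum of the `X i`, `i ∈ b`, divided by `√k`. -/
noncomputable def scaledSum {Ω : Type*} (X : ℕ → Ω → ℝ) (k : ℕ) (b : Finset ℕ) (ω : Ω) : ℝ :=
  (∑ i ∈ b, X i ω) / √k

lemma measurable_scaledSum {Ω : Type*} [MeasurableSpace Ω] {X : ℕ → Ω → ℝ} (hX : ∀ j, Measurable (X j)) (k : ℕ) (b : Finset ℕ) :
    Measurable (scaledSum X k b) := by
  unfold scaledSum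
  exact (Finset.measurable_sum b fun i _ => hX i).div_const _

lemma scaledSum_insert {Ω : Type*} {X : ℕ → Ω → ℝ} {k j : ℕ} {b : Finset ℕ} (hj : j ∉ b) (ω : Ω) :
    scaledSum X k (insert j b) ω = scaledSum X k b ω + X j ω / √k := by
  rw [scaledSum, scaledSum, Finset.sum_insert hj]
  ring

/-- If the square were not integrable, its Bochner integral would be `0` by convention and not `1`.
-/
lemma memLp_two_of_orthonormal {Ω : Type*} [MeasurableSpace Ω] {P : Measure Ω}
    {X : ℕ → Ω → ℝ} (hX : ∀ j, Measurable (X j))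
    (hXX : ∀ i j, ∫ ω, X i ω * X j ω ∂P = if i = j then 1 else 0) (j : ℕ) :
    MemLp (X j) 2 P := by
  rw [memLp_two_iff_integrable_sq (hX j).aestronglyMeasurable]
  by_contra h
  have h1 := hXX j j
  rw [if_pos rfl] at h1
  have h2 : ∫ ω, X j ω ^ 2 ∂P = 1 := by simpa [sq] using h1
  rw [integral_undef h] at h2
  norm_num at h2

variable {Ω : Type*} [MeasurableSpace Ω] {P : Measure Ω} [IsProbabilityMeasure P] {X : ℕ → Ω → ℝ}

/-- Bessel's inequality: expand `E (g - ∑ c_j X_j)² ≥ 0` and use `E g² ≤ D²`. -/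
lemma sum_sq_integral_mul_le (hX : ∀ j, Measurable (X j))
    (hXX : ∀ i j, ∫ ω, X i ω * X j ω ∂P = if i = j then 1 else 0)
    {g : Ω → ℝ} (hg : Measurable g) {D : ℝ} (hgD : ∀ ω, |g ω| ≤ D) (s : Finset ℕ) :
    ∑ j ∈ s, (∫ ω, g ω * X j ω ∂P) ^ 2 ≤ D ^ 2 := by
  have hX2 := memLp_two_of_orthonormal hX hXX
  have hg2 : MemLp g 2 P := MemLp.of_bound hg.aestronglyMeasurable D (ae_of_all _ hgD)
  set c : ℕ → ℝ := fun j => ∫ ω, g ω * X j ω ∂P with hc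
  have hgX : ∀ j, Integrable (fun ω => g ω * X j ω) P := fun j => hg2.integrable_mul (hX2 j)
  have hXi : ∀ i j, Integrable (fun ω => X i ω * X j ω) P :=
    fun i j => (hX2 i).integrable_mul (hX2 j)
  have hgg : Integrable (fun ω => g ω * g ω) P := hg2.integrable_mul hg2
  have h1 : ∫ ω, ∑ j ∈ s, c j * (g ω * X j ω) ∂P = ∑ j ∈ s, c j ^ 2 := by
    rw [integral_finsetSum _ fun j _ => (hgX j).const_mul _]
    refine Finset.sum_congr rfl fun j _ => ?_
    rw [integral_const_mul, sq]
  have h2 : ∫ ω, ∑ i ∈ s, ∑ j ∈ s, c i * c j * (X i ω * X j ω) ∂P = ∑ j ∈ s, c j ^ 2 := by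
    rw [integral_finsetSum _ fun i _ => integrable_finsetSum _ fun j _ => (hXi i j).const_mul _]
    refine Finset.sum_congr rfl fun i hi => ?_
    rw [integral_finsetSum _ fun j _ => (hXi i j).const_mul _]
    simp only [integral_const_mul, hXX, mul_ite, mul_one, mul_zero]
    rw [Finset.sum_ite_eq, if_pos hi, sq]
  have h3 : 0 ≤ ∫ ω, (g ω * g ω - 2 * ∑ j ∈ s, c j * (g ω * X j ω)
      + ∑ i ∈ s, ∑ j ∈ s, c i * c j * (X i ω * X j ω)) ∂P := by
    refine integral_nonneg fun ω => ?_
    have : g ω * g ω - 2 * ∑ j ∈ s, c j * (g ω * X j ω)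
        + ∑ i ∈ s, ∑ j ∈ s, c i * c j * (X i ω * X j ω) = (g ω - ∑ j ∈ s, c j * X j ω) ^ 2 := by
      have e1 : ∑ j ∈ s, c j * (g ω * X j ω) = g ω * ∑ j ∈ s, c j * X j ω := by
        rw [Finset.mul_sum]; exact Finset.sum_congr rfl fun j _ => by ring
      have e2 : ∑ i ∈ s, ∑ j ∈ s, c i * c j * (X i ω * X j ω) = (∑ j ∈ s, c j * X j ω) ^ 2 := by
        rw [sq, Finset.sum_mul_sum]
        exact Finset.sum_congr rfl fun i _ => Finset.sum_congr rfl fun j _ => by ring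
      rw [e1, e2]; ring
    simp only [Pi.zero_apply]
    rw [this]
    positivity
  have i1 : Integrable (fun ω => ∑ j ∈ s, c j * (g ω * X j ω)) P :=
    integrable_finsetSum _ fun j _ => (hgX j).const_mul _
  have i2 : Integrable (fun ω => ∑ i ∈ s, ∑ j ∈ s, c i * c j * (X i ω * X j ω)) P :=
    integrable_finsetSum _ fun i _ => integrable_finsetSum _ fun j _ => (hXi i j).const_mul _
  have i3 : Integrable (fun ω => g ω * g ω - 2 * ∑ j ∈ s, c j * (g ω * X j ω)) P :=
    hgg.sub (i1.const_mul 2)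
  rw [integral_add i3 i2, integral_sub hgg (i1.const_mul 2),
    integral_const_mul, h1, h2] at h3
  have h4 : ∫ ω, g ω * g ω ∂P ≤ D ^ 2 := by
    calc ∫ ω, g ω * g ω ∂P ≤ ∫ _, D ^ 2 ∂P := by
          refine integral_mono hgg (integrable_const _) fun ω => ?_
          have := sq_le_sq' (abs_le.1 (hgD ω)).1 (abs_le.1 (hgD ω)).2
          simpa [sq] using this
      _ = D ^ 2 := by simp
  linarith

/-- The change of `E v(S_b)` under the inclusion or removal of one index. -/
lemma abs_integral_toggle_le (hX : ∀ j, Measurable (X j))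
    (hXX : ∀ i j, ∫ ω, X i ω * X j ω ∂P = if i = j then 1 else 0)
    {v v' : ℝ → ℝ} (hv : Measurable v) (hv' : Measurable v') {D K : ℝ}
    (hv1 : ∀ y, |v y| ≤ 1) (hD : ∀ y, |v' y| ≤ D)
    (hK : ∀ y z, |v (y + z) - v y - v' y * z| ≤ K * z ^ 2)
    {Y Z : Ω → ℝ} (hY : Measurable Y) (hZ : Measurable Z) {k : ℕ} (hk : 1 ≤ k) (j : ℕ) {σ : ℝ}
    (hσ : |σ| = 1) (hYZ : ∀ ω, Z ω = Y ω + σ * (X j ω / √k)) :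
    |(∫ ω, v (Z ω) ∂P) - ∫ ω, v (Y ω) ∂P|
      ≤ |∫ ω, v' (Y ω) * X j ω ∂P| / √k + K / k := by
  have hk0 : (0 : ℝ) < k := by exact_mod_cast hk
  have hX2 := memLp_two_of_orthonormal hX hXX
  have ivZ : Integrable (fun ω => v (Z ω)) P :=
    Integrable.of_bound (hv.comp hZ).aestronglyMeasurable 1 (ae_of_all _ fun ω => hv1 _)
  have ivY : Integrable (fun ω => v (Y ω)) P :=
    Integrable.of_bound (hv.comp hY).aestronglyMeasurable 1 (ae_of_all _ fun ω => hv1 _)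
  have iX : Integrable (fun ω => v' (Y ω) * X j ω) P :=
    (MemLp.of_bound (p := 2) (hv'.comp hY).aestronglyMeasurable D
      (ae_of_all _ fun ω => hD _)).integrable_mul (hX2 j)
  have iXX : Integrable (fun ω => X j ω * X j ω) P := (hX2 j).integrable_mul (hX2 j)
  have e1 : (∫ ω, v (Z ω) ∂P) - ∫ ω, v (Y ω) ∂P
      = (∫ ω, (v (Z ω) - v (Y ω) - σ / √k * (v' (Y ω) * X j ω)) ∂P)
        + σ / √k * ∫ ω, v' (Y ω) * X j ω ∂P := by
    have iZY : Integrable (fun ω => v (Z ω) - v (Y ω)) P := ivZ.sub ivY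
    rw [integral_sub iZY (iX.const_mul _), integral_sub ivZ ivY, integral_const_mul]
    ring
  have hσ2 : σ ^ 2 = 1 := by rw [← sq_abs, hσ, one_pow]
  -- Only the second moment enters: the remainder `K z²` has mean `K / k` because `E X_j² = 1`.
  have e2 : |∫ ω, (v (Z ω) - v (Y ω) - σ / √k * (v' (Y ω) * X j ω)) ∂P| ≤ K / k := by
    calc |∫ ω, (v (Z ω) - v (Y ω) - σ / √k * (v' (Y ω) * X j ω)) ∂P|
        ≤ ∫ ω, |v (Z ω) - v (Y ω) - σ / √k * (v' (Y ω) * X j ω)| ∂P := abs_integral_le_integral_abs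
      _ ≤ ∫ ω, K / k * (X j ω * X j ω) ∂P := by
          refine integral_mono ((ivZ.sub ivY).sub (iX.const_mul _)).abs (iXX.const_mul _) fun ω => ?_
          have h := hK (Y ω) (σ * (X j ω / √k))
          rw [← hYZ] at h
          have h1 : v' (Y ω) * (σ * (X j ω / √k)) = σ / √k * (v' (Y ω) * X j ω) := by ring
          have h2 : K * (σ * (X j ω / √k)) ^ 2 = K / k * (X j ω * X j ω) := by
            rw [mul_pow, hσ2, div_pow, Real.sq_sqrt hk0.le]
            ring
          rwa [h1, h2] at h
      _ = K / k := by rw [integral_const_mul, hXX, if_pos rfl, mul_one]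
  rw [e1]
  refine (abs_add_le _ _).trans ?_
  rw [abs_mul, abs_div, hσ, abs_of_nonneg (Real.sqrt_nonneg _), one_div_mul_eq_div]
  linarith

/-- A cutoff of the cardinality at the level `3 * k`. -/
noncomputable def cardCutoff (k : ℕ) (b : Finset ℕ) : ℝ :=
  max 0 (min 1 (3 - (b.card : ℝ) / k))

lemma cardCutoff_mem_Icc (k : ℕ) (b : Finset ℕ) : cardCutoff k b ∈ Set.Icc (0 : ℝ) 1 :=
  ⟨le_max_left _ _, max_le zero_le_one (min_le_left _ _)⟩

lemma cardCutoff_eq_one {k : ℕ} (hk : 1 ≤ k) {b : Finset ℕ} (hb : b.card ≤ 2 * k) :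
    cardCutoff k b = 1 := by
  have hk0 : (0 : ℝ) < k := by exact_mod_cast hk
  have : (b.card : ℝ) / k ≤ 2 := by
    rw [div_le_iff₀ hk0]; exact_mod_cast hb
  rw [cardCutoff, min_eq_left (by linarith), max_eq_right zero_le_one]

lemma cardCutoff_eq_zero {k : ℕ} (hk : 1 ≤ k) {b : Finset ℕ} (hb : 3 * k ≤ b.card) :
    cardCutoff k b = 0 := by
  have hk0 : (0 : ℝ) < k := by exact_mod_cast hk
  have : 3 ≤ (b.card : ℝ) / k := by
    rw [le_div_iff₀ hk0]; exact_mod_cast hb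
  rw [cardCutoff, max_eq_left ((min_le_right _ _).trans (by linarith))]

lemma abs_cardCutoff_sub_le {k : ℕ} (hk : 1 ≤ k) {b c : Finset ℕ} (h : c.card = b.card + 1) :
    |cardCutoff k c - cardCutoff k b| ≤ 1 / k := by
  rw [cardCutoff, cardCutoff, h, max_comm 0, max_comm 0, min_comm 1, min_comm 1]
  refine (abs_max_sub_max_le_abs _ _ _).trans ((abs_min_sub_min_le_max _ _ _ _).trans ?_)
  rw [sub_self, abs_zero, show (3 - ((b.card + 1 : ℕ) : ℝ) / k) - (3 - (b.card : ℝ) / k)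
    = -(1 / k) by push_cast; ring, abs_neg, abs_of_nonneg (by positivity)]
  exact max_le le_rfl (by positivity)

lemma sum_toggle_weight_le {p : ℝ} (hp : 0 ≤ p) {s b : Finset ℕ} (hb : b ⊆ s) :
    ∑ j ∈ s, (if j ∈ b then 1 - p else p) ≤ b.card + p * s.card := by
  calc ∑ j ∈ s, (if j ∈ b then 1 - p else p) ≤ ∑ j ∈ s, ((if j ∈ b then 1 else 0) + p) := by
        refine Finset.sum_le_sum fun j _ => ?_
        split_ifs <;> linarith
    _ = b.card + p * s.card := by
        rw [Finset.sum_add_distrib, Finset.sum_ite_mem, Finset.inter_eq_right.2 hb]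
        simp [mul_comm]

/-- The gradient of the truncated functional `E v(S_b)` is of order `k⁻¹`. -/
theorem bernoulliEnergy_cutoff_le (hX : ∀ j, Measurable (X j))
    (hXX : ∀ i j, ∫ ω, X i ω * X j ω ∂P = if i = j then 1 else 0)
    {v v' : ℝ → ℝ} (hv : Measurable v) (hv' : Measurable v') {D K : ℝ}
    (hv1 : ∀ y, |v y| ≤ 1) (hD : ∀ y, |v' y| ≤ D) (hK0 : 0 ≤ K)
    (hK : ∀ y z, |v (y + z) - v y - v' y * z| ≤ K * z ^ 2)
    {k n : ℕ} (hk : 1 ≤ k) {p : ℝ} (hp : 0 ≤ p) (hp1 : p ≤ 1) (hpn : p * n = k)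
    {b : Finset ℕ} (hb : b ⊆ Finset.range n) :
    bernoulliEnergy p (Finset.range n)
        (fun b => cardCutoff k b * ∫ ω, v (scaledSum X k b ω) ∂P) b
      ≤ (2 * D ^ 2 + 8 * (K + 1) ^ 2) / k := by
  have hk0 : (0 : ℝ) < k := by exact_mod_cast hk
  set f : Finset ℕ → ℝ := fun b => ∫ ω, v (scaledSum X k b ω) ∂P with hf
  have hf1 : ∀ b, |f b| ≤ 1 := fun b => by
    have := norm_integral_le_of_norm_le_const (μ := P) (f := fun ω => v (scaledSum X k b ω))
      (C := 1) (ae_of_all _ fun ω => hv1 _)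
    simpa using this
  -- Strictness matters: if `|b| > 3k`, removing one index leaves at least `3k`, so the cutoff
  -- vanishes at both ends of every toggle.
  rcases Nat.lt_or_ge (3 * k) b.card with hcard | hcard
  · have : bernoulliEnergy p (Finset.range n) (fun b => cardCutoff k b * f b) b = 0 := by
      refine Finset.sum_eq_zero fun j _ => ?_
      have h1 : 3 * k ≤ (insert j b).card :=
        hcard.le.trans (Finset.card_le_card (Finset.subset_insert j b))
      have h2 : 3 * k ≤ (b.erase j).card := by
        have := Finset.pred_card_le_card_erase (s := b) (a := j)
        omega
      simp [cardCutoff_eq_zero hk h1, cardCutoff_eq_zero hk h2]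
    rw [this]
    positivity
  set A : ℕ → ℝ := fun j => ∫ ω, v' (scaledSum X k b ω) * X j ω ∂P with hA
  have hstep : ∀ j, |f (insert j b) - f (b.erase j)| ≤ |A j| / √k + K / k := by
    intro j
    by_cases hj : j ∈ b
    · rw [Finset.insert_eq_of_mem hj, abs_sub_comm]
      refine abs_integral_toggle_le hX hXX hv hv' hv1 hD hK (measurable_scaledSum hX k b)
        (measurable_scaledSum hX k _) hk j (σ := -1) (by simp) fun ω => ?_
      have := scaledSum_insert (X := X) (k := k) (Finset.notMem_erase j b) ω
      rw [Finset.insert_erase hj] at this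
      linarith
    · rw [Finset.erase_eq_of_notMem hj]
      refine abs_integral_toggle_le hX hXX hv hv' hv1 hD hK (measurable_scaledSum hX k b)
        (measurable_scaledSum hX k _) hk j (σ := 1) (by simp) fun ω => ?_
      rw [scaledSum_insert hj, one_mul]
  -- The cutoff is `1 / k`-Lipschitz, so it costs no more than a second-order term: `K` becomes `K +
  -- 1`.
  have hstep2 : ∀ j, |cardCutoff k (insert j b) * f (insert j b)
      - cardCutoff k (b.erase j) * f (b.erase j)| ≤ |A j| / √k + (K + 1) / k := by
    intro j
    have h1 : |cardCutoff k (insert j b) - cardCutoff k (b.erase j)| ≤ 1 / k := by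
      refine abs_cardCutoff_sub_le hk ?_
      by_cases hj : j ∈ b
      · rw [Finset.insert_eq_of_mem hj, Finset.card_erase_add_one hj]
      · rw [Finset.erase_eq_of_notMem hj, Finset.card_insert_of_notMem hj]
    have h2 : cardCutoff k (insert j b) * f (insert j b) - cardCutoff k (b.erase j) * f (b.erase j)
        = cardCutoff k (insert j b) * (f (insert j b) - f (b.erase j))
          + (cardCutoff k (insert j b) - cardCutoff k (b.erase j)) * f (b.erase j) := by ring
    have h3 := cardCutoff_mem_Icc k (insert j b)
    rw [h2]
    refine (abs_add_le _ _).trans ?_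
    rw [abs_mul, abs_mul, abs_of_nonneg h3.1]
    have h4 := mul_le_mul h3.2 (hstep j) (abs_nonneg _) zero_le_one
    have h5 := mul_le_mul h1 (hf1 (b.erase j)) (abs_nonneg _) (by positivity)
    rw [add_div]
    linarith
  have hsq : ∀ j, (cardCutoff k (insert j b) * f (insert j b)
      - cardCutoff k (b.erase j) * f (b.erase j)) ^ 2
      ≤ 2 / k * A j ^ 2 + 2 * ((K + 1) / k) ^ 2 := by
    intro j
    rw [← sq_abs]
    have h1 := pow_le_pow_left₀ (abs_nonneg _) (hstep2 j) 2
    have h2 : (|A j| / √k) ^ 2 = A j ^ 2 / k := by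
      rw [div_pow, sq_abs, Real.sq_sqrt hk0.le]
    have h3 : (|A j| / √k + (K + 1) / k) ^ 2
        ≤ 2 * (|A j| / √k) ^ 2 + 2 * ((K + 1) / k) ^ 2 := by
      nlinarith [sq_nonneg (|A j| / √k - (K + 1) / k)]
    rw [h2] at h3
    calc _ ≤ _ := h1
      _ ≤ _ := h3
      _ = _ := by ring
  have hc0 : ∀ j, 0 ≤ (if j ∈ b then 1 - p else p) := fun j => by split_ifs <;> linarith
  have hc1 : ∀ j, (if j ∈ b then 1 - p else p) ≤ 1 := fun j => by split_ifs <;> linarith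
  have hbessel : ∑ j ∈ Finset.range n, A j ^ 2 ≤ D ^ 2 :=
    sum_sq_integral_mul_le hX hXX (hv'.comp (measurable_scaledSum hX k b)) (fun ω => hD _) _
  -- The errors of size `1 / k` are not summable over all `n` indices; the weights reduce their
  -- effective number to `|b| + pn ≤ 4k`.
  have hweight : ∑ j ∈ Finset.range n, (if j ∈ b then 1 - p else p) ≤ 4 * k := by
    refine (sum_toggle_weight_le hp hb).trans ?_
    rw [Finset.card_range, hpn]
    have : (b.card : ℝ) ≤ 3 * k := by exact_mod_cast hcard
    linarith
  calc bernoulliEnergy p (Finset.range n) (fun b => cardCutoff k b * f b) b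
      ≤ ∑ j ∈ Finset.range n, (2 / k * A j ^ 2
          + 2 * ((K + 1) / k) ^ 2 * (if j ∈ b then 1 - p else p)) := by
        refine Finset.sum_le_sum fun j _ => ?_
        have h1 := mul_le_mul_of_nonneg_left (hsq j) (hc0 j)
        have h2 : (if j ∈ b then 1 - p else p) * (2 / k * A j ^ 2) ≤ 1 * (2 / k * A j ^ 2) :=
          mul_le_mul_of_nonneg_right (hc1 j) (by positivity)
        linarith
    _ = 2 / k * ∑ j ∈ Finset.range n, A j ^ 2
          + 2 * ((K + 1) / k) ^ 2 * ∑ j ∈ Finset.range n, (if j ∈ b then 1 - p else p) := by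
        rw [Finset.sum_add_distrib, Finset.mul_sum, Finset.mul_sum]
    _ ≤ 2 / k * D ^ 2 + 2 * ((K + 1) / k) ^ 2 * (4 * k) := by gcongr
    _ = _ := by field_simp; ring

end Energy

/-! ### Elementary properties of the Lévy distance. -/

section Levy

lemma levyDistance_le {F G : ℝ → ℝ} {d : ℝ} (hd : 0 ≤ d) (h : ∀ x, F x ≤ G (x + d) + d)
    (h' : ∀ x, G x ≤ F (x + d) + d) : levyDistance F G ≤ d := by
  refine csInf_le ⟨0, fun _ h => h.1⟩ ⟨hd, fun x => ⟨?_, h x⟩⟩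
  have := h' (x - d)
  rw [sub_add_cancel] at this
  linarith

lemma levyDistance_nonneg (F G : ℝ → ℝ) : 0 ≤ levyDistance F G :=
  Real.sInf_nonneg fun _ h => h.1

lemma levyDistance_le_one {F G : ℝ → ℝ} (hF : ∀ x, F x ∈ Set.Icc (0 : ℝ) 1)
    (hG : ∀ x, G x ∈ Set.Icc (0 : ℝ) 1) : levyDistance F G ≤ 1 :=
  levyDistance_le zero_le_one (fun x => by linarith [(hF x).2, (hG (x + 1)).1])
    fun x => by linarith [(hG x).2, (hF (x + 1)).1]

/-- Triangle inequality, with a nearly optimal `e` in place of the infimum for the second leg. -/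
lemma levyDistance_le_add {F G H : ℝ → ℝ} (hG : ∀ x, G x ∈ Set.Icc (0 : ℝ) 1)
    (hH : ∀ x, H x ∈ Set.Icc (0 : ℝ) 1) {d : ℝ} (hd : 0 ≤ d) (h : ∀ x, F x ≤ G (x + d) + d)
    (h' : ∀ x, G x ≤ F (x + d) + d) : levyDistance F H ≤ d + levyDistance G H := by
  refine le_of_forall_pos_lt_add fun η hη => ?_
  obtain ⟨e, ⟨he0, he⟩, hlt⟩ := exists_lt_of_csInf_lt
    (s := {δ : ℝ | 0 ≤ δ ∧ ∀ x : ℝ, H (x - δ) - δ ≤ G x ∧ G x ≤ H (x + δ) + δ})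
    ⟨1, zero_le_one, fun x => ⟨by linarith [(hG x).1, (hH (x - 1)).2],
      by linarith [(hG x).2, (hH (x + 1)).1]⟩⟩
    (show levyDistance G H < levyDistance G H + η by linarith)
  have : levyDistance F H ≤ d + e := by
    refine levyDistance_le (by positivity) (fun x => ?_) fun x => ?_
    · have h1 := h x
      have h2 := (he (x + d)).2
      rw [add_assoc] at h2
      linarith
    · have h1 := (he (x + e)).1
      have h2 := h' (x + e)
      rw [add_sub_cancel_right] at h1
      rw [add_assoc, add_comm e d] at h2
      linarith
  linarith

/-- Two distribution functions which are close at the points of a grid are close in the Lévy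
sense. -/
lemma forall_le_of_grid {F G : ℝ → ℝ} (hF : Monotone F) (hG : Monotone G)
    (hF1 : ∀ x, F x ∈ Set.Icc (0 : ℝ) 1) (hG1 : ∀ x, G x ∈ Set.Icc (0 : ℝ) 1) {δ : ℝ}
    (hδ : 0 < δ) (hleft : F (-(1 / δ)) ≤ δ) (hright : 1 - δ ≤ F (1 / δ)) {N : ℕ}
    (hN : 2 / δ ^ 2 + 4 ≤ N)
    (hFG : ∀ i < N, F (-(1 / δ) - δ + i * δ) ≤ G (-(1 / δ) - δ + i * δ + δ) + δ)
    (hGF : ∀ i < N, G (-(1 / δ) - δ + i * δ) ≤ F (-(1 / δ) - δ + i * δ + δ) + δ) (x : ℝ) :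
    F x ≤ G (x + 2 * δ) + 2 * δ ∧ G x ≤ F (x + 2 * δ) + 2 * δ := by
  set x₀ := -(1 / δ) - δ with hx₀
  have hN4 : (4 : ℝ) ≤ N := by have : 0 ≤ 2 / δ ^ 2 := by positivity
                               linarith
  have hN4' : 4 ≤ N := by exact_mod_cast hN4
  have hNδ : 2 / δ + 4 * δ ≤ N * δ := by
    have := mul_le_mul_of_nonneg_right hN hδ.le
    have e : (2 / δ ^ 2 + 4) * δ = 2 / δ + 4 * δ := by field_simp
    linarith
  have h2δ : 2 / δ = 1 / δ + 1 / δ := by ring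
  rcases le_or_gt x x₀ with hx | hx
  -- Tails are assumed for `F` only. The grid starts one step left of `-1 / δ`, so its first
  -- comparison passes the left tail bound on to `G`.
  · have h1 : F x ≤ F (-(1 / δ)) := hF (by linarith)
    have h2 : G x ≤ G x₀ := hG hx
    have h3 := hGF 0 (by omega)
    rw [Nat.cast_zero, zero_mul, add_zero, show x₀ + δ = -(1 / δ) by rw [hx₀]; ring] at h3
    have := (hG1 (x + 2 * δ)).1
    have := (hF1 (x + 2 * δ)).1
    constructor <;> linarith
  set i := ⌈(x - x₀) / δ⌉₊ with hi
  have hi1 : x ≤ x₀ + i * δ := by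
    have := Nat.le_ceil ((x - x₀) / δ)
    rw [div_le_iff₀ hδ] at this
    linarith
  have hi2 : x₀ + i * δ < x + δ := by
    have := Nat.ceil_lt_add_one (a := (x - x₀) / δ) (by have := sub_pos.2 hx; positivity)
    rw [← hi, ← sub_lt_iff_lt_add, lt_div_iff₀ hδ] at this
    linarith
  rcases lt_or_ge i N with hiN | hiN
  · have h1 := hFG i hiN
    have h2 := hGF i hiN
    have h3 : F x ≤ F (x₀ + i * δ) := hF hi1
    have h4 : G x ≤ G (x₀ + i * δ) := hG hi1
    have h5 : F (x₀ + i * δ + δ) ≤ F (x + 2 * δ) := hF (by linarith)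
    have h6 : G (x₀ + i * δ + δ) ≤ G (x + 2 * δ) := hG (by linarith)
    constructor <;> linarith
  · have hiN' : (N : ℝ) ≤ i := by exact_mod_cast hiN
    have hlow : x₀ + N * δ < x + δ := by
      have := mul_le_mul_of_nonneg_right hiN' hδ.le
      linarith
    -- This grid point already lies beyond `1 / δ`, where `F ≥ 1 - δ`; the comparison transfers that
    -- to `G`.
    have h1 := hFG (N - 2) (by omega)
    rw [Nat.cast_sub (by omega), Nat.cast_ofNat] at h1
    have h2 : F (1 / δ) ≤ F (x₀ + (N - 2) * δ) := hF (by linarith)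
    have h3 : G (x₀ + (N - 2) * δ + δ) ≤ G (x + 2 * δ) := hG (by linarith)
    have h4 : F (1 / δ) ≤ F (x + 2 * δ) := hF (by linarith)
    have := (hF1 x).2
    have := (hG1 x).2
    constructor <;> linarith

end Levy

/-! ### Distribution functions and smooth test functions. -/

section DistFun

lemma distFun_mem_Icc {Ω : Type*} [MeasurableSpace Ω] (P : Measure Ω) [IsProbabilityMeasure P]
    (Y : Ω → ℝ) (x : ℝ) : distFun P Y x ∈ Set.Icc (0 : ℝ) 1 :=
  ⟨measureReal_nonneg, measureReal_le_one⟩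

lemma monotone_distFun {Ω : Type*} [MeasurableSpace Ω] (P : Measure Ω) [IsProbabilityMeasure P]
    (Y : Ω → ℝ) : Monotone (distFun P Y) :=
  fun _ _ h => measureReal_mono fun _ hω => le_trans hω h

/-- A smooth approximation of the indicator function of `(-∞, x]`. -/
noncomputable def levyTest (x δ y : ℝ) : ℝ := 1 - smoothStep ((y - x) / δ)

lemma measurable_levyTest (x δ : ℝ) : Measurable (levyTest x δ) := by
  have := continuous_smoothStep
  have : Continuous (levyTest x δ) := by unfold levyTest; fun_prop
  exact this.measurable

lemma levyTest_mem_Icc (x δ y : ℝ) : levyTest x δ y ∈ Set.Icc (0 : ℝ) 1 := by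
  have := smoothStep_mem_Icc ((y - x) / δ)
  exact ⟨sub_nonneg.2 this.2, sub_le_self _ this.1⟩

lemma abs_levyTest_le_one (x δ y : ℝ) : |levyTest x δ y| ≤ 1 := by
  have := levyTest_mem_Icc x δ y
  rw [abs_of_nonneg this.1]
  exact this.2

lemma integrable_levyTest {Ω : Type*} [MeasurableSpace Ω] {P : Measure Ω}
    [IsProbabilityMeasure P] {Y : Ω → ℝ} (hY : Measurable Y) (x δ : ℝ) :
    Integrable (fun ω => levyTest x δ (Y ω)) P :=
  Integrable.of_bound ((measurable_levyTest x δ).comp hY).aestronglyMeasurable 1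
    (ae_of_all _ fun _ => abs_levyTest_le_one _ _ _)

lemma distFun_eq_integral {Ω : Type*} [MeasurableSpace Ω] (P : Measure Ω) {Y : Ω → ℝ}
    (hY : Measurable Y) (x : ℝ) :
    distFun P Y x = ∫ ω, {ω | Y ω ≤ x}.indicator (fun _ => (1 : ℝ)) ω ∂P := by
  rw [integral_indicator_const _ (measurableSet_le hY measurable_const)]
  simp [distFun]

lemma distFun_le_integral_levyTest {Ω : Type*} [MeasurableSpace Ω] {P : Measure Ω}
    [IsProbabilityMeasure P] {Y : Ω → ℝ} (hY : Measurable Y) (x : ℝ) {δ : ℝ} (hδ : 0 < δ) :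
    distFun P Y x ≤ ∫ ω, levyTest x δ (Y ω) ∂P := by
  rw [distFun_eq_integral P hY]
  refine integral_mono ((integrable_const 1).indicator (measurableSet_le hY measurable_const))
    (integrable_levyTest hY x δ) fun ω => ?_
  refine Set.indicator_le' (f := fun _ => (1 : ℝ)) (g := fun ω => levyTest x δ (Y ω))
    (fun ω hω => ?_) (fun ω _ => (levyTest_mem_Icc _ _ _).1) ω
  rw [levyTest, smoothStep_of_nonpos, sub_zero]
  exact div_nonpos_of_nonpos_of_nonneg (sub_nonpos.2 hω) hδ.le

lemma integral_levyTest_le_distFun {Ω : Type*} [MeasurableSpace Ω] {P : Measure Ω}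
    [IsProbabilityMeasure P] {Y : Ω → ℝ} (hY : Measurable Y) (x : ℝ) {δ : ℝ} (hδ : 0 < δ) :
    ∫ ω, levyTest x δ (Y ω) ∂P ≤ distFun P Y (x + δ) := by
  rw [distFun_eq_integral P hY]
  refine integral_mono (integrable_levyTest hY x δ)
    ((integrable_const 1).indicator (measurableSet_le hY measurable_const)) fun ω => ?_
  by_cases h : Y ω ≤ x + δ
  · have : ω ∈ {ω | Y ω ≤ x + δ} := h
    rw [Set.indicator_of_mem this]
    exact (levyTest_mem_Icc _ _ _).2
  · have : ω ∉ {ω | Y ω ≤ x + δ} := h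
    rw [Set.indicator_of_notMem this, levyTest, smoothStep_of_one_le, sub_self]
    rw [le_div_iff₀ hδ]
    push Not at h
    linarith

/-- Chebyshev: `P(|Y| ≥ 1 / δ) ≤ δ² ≤ δ`. -/
lemma distFun_tail_le {Ω : Type*} [MeasurableSpace Ω] {P : Measure Ω} [IsProbabilityMeasure P]
    {Y : Ω → ℝ} (hY : MemLp Y 2 P) (hYm : Measurable Y) (hY1 : ∫ ω, Y ω ^ 2 ∂P ≤ 1) {δ : ℝ}
    (hδ : 0 < δ) (hδ1 : δ ≤ 1) :
    distFun P Y (-(1 / δ)) ≤ δ ∧ 1 - δ ≤ distFun P Y (1 / δ) := by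
  have hM := mul_meas_ge_le_integral_of_nonneg (μ := P) (f := fun ω => Y ω ^ 2)
    (ae_of_all _ fun ω => sq_nonneg _) hY.integrable_sq (1 / δ ^ 2)
  have h1 : P.real {ω | 1 / δ ^ 2 ≤ Y ω ^ 2} ≤ δ := by
    have h2 : 1 / δ ^ 2 * P.real {ω | 1 / δ ^ 2 ≤ Y ω ^ 2} ≤ 1 := hM.trans hY1
    rw [one_div_mul_eq_div, div_le_one (by positivity)] at h2
    nlinarith
  have hinv : 1 / δ ^ 2 = (1 / δ) ^ 2 := by rw [div_pow, one_pow]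
  have hpos : 0 < 1 / δ := by positivity
  constructor
  · refine (measureReal_mono fun ω hω => ?_).trans h1
    have hω : Y ω ≤ -(1 / δ) := hω
    change 1 / δ ^ 2 ≤ Y ω ^ 2
    rw [hinv]
    nlinarith
  · have h2 : distFun P Y (1 / δ) = 1 - P.real {ω | Y ω ≤ 1 / δ}ᶜ := by
      rw [probReal_compl_eq_one_sub (measurableSet_le hYm measurable_const), distFun]
      ring
    have h3 : P.real {ω | Y ω ≤ 1 / δ}ᶜ ≤ δ := by
      refine (measureReal_mono fun ω hω => ?_).trans h1
      have hω : ¬ Y ω ≤ 1 / δ := hω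
      push Not at hω
      change 1 / δ ^ 2 ≤ Y ω ^ 2
      rw [hinv]
      nlinarith
    rw [h2]
    linarith

end DistFun

/-! ### Concentration of `F_τ` on the slice. -/

section Slice

lemma integral_scaledSum_sq {Ω : Type*} [MeasurableSpace Ω] {P : Measure Ω}
    {X : ℕ → Ω → ℝ} (hX : ∀ j, Measurable (X j))
    (hXX : ∀ i j, ∫ ω, X i ω * X j ω ∂P = if i = j then 1 else 0) {k : ℕ} (hk : 1 ≤ k)
    {τ : Finset ℕ} (hτ : τ.card = k) : ∫ ω, scaledSum X k τ ω ^ 2 ∂P = 1 := by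
  have hX2 := memLp_two_of_orthonormal hX hXX
  have hk0 : (0 : ℝ) < k := by exact_mod_cast hk
  have hXi : ∀ i j, Integrable (fun ω => X i ω * X j ω) P :=
    fun i j => (hX2 i).integrable_mul (hX2 j)
  have e : ∀ ω, scaledSum X k τ ω ^ 2 = 1 / k * ∑ i ∈ τ, ∑ j ∈ τ, X i ω * X j ω := fun ω => by
    rw [scaledSum, div_pow, Real.sq_sqrt hk0.le, sq, Finset.sum_mul_sum]; ring
  simp only [e]
  rw [integral_const_mul, integral_finsetSum _ fun i _ => integrable_finsetSum _ fun j _ =>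
    hXi i j]
  have : ∀ i ∈ τ, ∫ ω, ∑ j ∈ τ, X i ω * X j ω ∂P = 1 := fun i hi => by
    rw [integral_finsetSum _ fun j _ => hXi i j]
    simp [hXX, hi]
  rw [Finset.sum_congr rfl this]
  simp [hτ, hk0.ne']

lemma memLp_scaledSum {Ω : Type*} [MeasurableSpace Ω] {P : Measure Ω}
    {X : ℕ → Ω → ℝ} (hX : ∀ j, Measurable (X j))
    (hXX : ∀ i j, ∫ ω, X i ω * X j ω ∂P = if i = j then 1 else 0) (k : ℕ) (τ : Finset ℕ) :
    MemLp (scaledSum X k τ) 2 P := by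
  have : MemLp (fun ω => (√k)⁻¹ * ∑ i ∈ τ, X i ω) 2 P :=
    (memLp_finsetSum τ fun i _ => memLp_two_of_orthonormal hX hXX i).const_mul _
  refine this.congr_norm (measurable_scaledSum hX k τ).aestronglyMeasurable (ae_of_all _ fun ω => ?_)
  rw [scaledSum, div_eq_inv_mul]

variable {Ω : Type*} [MeasurableSpace Ω] {P : Measure Ω} [IsProbabilityMeasure P] {X : ℕ → Ω → ℝ}

lemma sliceMeasure_le_one (n k : ℕ) (A : Set (Finset ℕ)) : sliceMeasure n k A ≤ 1 := by
  classical
  refine div_le_one_of_le₀ ?_ (Nat.cast_nonneg _)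
  exact_mod_cast Finset.card_filter_le _ _

lemma sliceMeasure_eq_zero {n k : ℕ} {A : Set (Finset ℕ)} (h : ∀ τ ∈ indexSets n k, τ ∉ A) :
    sliceMeasure n k A = 0 := by
  classical
  rw [sliceMeasure, Finset.filter_false_of_mem h]
  simp

lemma sliceMeasure_le_sum {n k : ℕ} {A : Set (Finset ℕ)} {N : ℕ} {B : ℕ → Set (Finset ℕ)}
    (h : ∀ τ ∈ indexSets n k, τ ∈ A → ∃ i < N, τ ∈ B i) :
    sliceMeasure n k A ≤ ∑ i ∈ Finset.range N, sliceMeasure n k (B i) := by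
  classical
  simp only [sliceMeasure]
  rw [← Finset.sum_div]
  refine div_le_div_of_nonneg_right ?_ (Nat.cast_nonneg _)
  have : (indexSets n k).filter (fun τ => τ ∈ A)
      ⊆ (Finset.range N).biUnion fun i => (indexSets n k).filter (fun τ => τ ∈ B i) := by
    intro τ hτ
    obtain ⟨h1, h2⟩ := Finset.mem_filter.1 hτ
    obtain ⟨i, hi, hi2⟩ := h τ h1 h2
    exact Finset.mem_biUnion.2 ⟨i, Finset.mem_range.2 hi, Finset.mem_filter.2 ⟨h1, hi2⟩⟩
  have h2 := (Finset.card_le_card this).trans Finset.card_biUnion_le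
  convert (Nat.cast_le (α := ℝ)).2 h2
  push_cast
  rfl

lemma bernoulliMean_mem_Icc {p : ℝ} (hp : 0 ≤ p) (hp1 : p ≤ 1) {s : Finset ℕ}
    {f : Finset ℕ → ℝ} (hf : ∀ b, f b ∈ Set.Icc (0 : ℝ) 1) :
    bernoulliMean p s f ∈ Set.Icc (0 : ℝ) 1 := by
  constructor
  · rw [← bernoulliMean_const p s 0]
    exact bernoulliMean_mono hp hp1 fun b _ => (hf b).1
  · rw [← bernoulliMean_const p s 1]
    exact bernoulliMean_mono hp hp1 fun b _ => (hf b).2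

/-- Concentration on the slice of the functional `E v(S_τ)` for a smooth step `v` of width `δ`. -/
theorem sliceMeasure_levyTest_le (hX : ∀ j, Measurable (X j))
    (hXX : ∀ i j, ∫ ω, X i ω * X j ω ∂P = if i = j then 1 else 0)
    {n k : ℕ} (hk : 1 ≤ k) (hkn : k ≤ n) {δ : ℝ} (hδ : 0 < δ) (hδ1 : δ ≤ 1)
    (hkδ : (Real.exp 1 / 4) ^ k ≤ δ / 2) (x : ℝ) :
    sliceMeasure n k {τ | τ.card = k ∧ δ < |(∫ ω, levyTest x δ (scaledSum X k τ ω) ∂P)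
        - bernoulliMean (k / n) (Finset.range n)
          (fun b => ∫ ω, levyTest x δ (scaledSum X k b ω) ∂P)|}
      ≤ 8 * √k * Real.exp (-(k * δ ^ 6 / 3328)) := by
  classical
  have hk0 : (0 : ℝ) < k := by exact_mod_cast hk
  have hn0 : (0 : ℝ) < n := by exact_mod_cast (by omega : 0 < n)
  set p : ℝ := k / n with hp
  have hp0 : 0 ≤ p := by positivity
  have hp1 : p ≤ 1 := div_le_one_of_le₀ (by exact_mod_cast hkn) hn0.le
  have hpn : p * n = k := by rw [hp]; field_simp
  set T : Finset ℕ → ℝ := fun b => ∫ ω, levyTest x δ (scaledSum X k b ω) ∂P with hT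
  have hT1 : ∀ b, T b ∈ Set.Icc (0 : ℝ) 1 := fun b => by
    refine ⟨integral_nonneg fun ω => (levyTest_mem_Icc _ _ _).1, ?_⟩
    have := integral_mono (integrable_levyTest (P := P) (measurable_scaledSum hX k b) x δ)
      (integrable_const 1) fun ω => (levyTest_mem_Icc x δ _).2
    simpa using this
  set h : Finset ℕ → ℝ := fun b => cardCutoff k b * T b with hh
  -- With `D = 2 / δ` and `K = 4 / δ²`, the energy times `k δ⁴` is at most `8δ² + 8(4 + δ²)² ≤ 208`.
  have hV : ∀ b ⊆ Finset.range n,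
      bernoulliEnergy p (Finset.range n) h b ≤ 208 / (δ ^ 4 * k) := by
    intro b hb
    refine (bernoulliEnergy_cutoff_le (P := P) hX hXX (measurable_levyTest x δ)
      (v' := fun y => -(smoothStepDeriv ((y - x) / δ) / δ)) (D := 2 / δ) (K := 4 / δ ^ 2)
      ?_ (abs_levyTest_le_one x δ) ?_ (by positivity) ?_ hk hp0 hp1 hpn hb).trans ?_
    · have := continuous_smoothStepDeriv
      have : Continuous (fun y => -(smoothStepDeriv ((y - x) / δ) / δ)) := by fun_prop
      exact this.measurable
    · intro y
      rw [abs_neg, abs_div, abs_of_pos hδ]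
      exact div_le_div_of_nonneg_right (abs_smoothStepDeriv_le _) hδ.le
    · intro y z
      have h1 := abs_smoothStep_taylor_le ((y - x) / δ) (z / δ)
      have e1 : (y + z - x) / δ = (y - x) / δ + z / δ := by ring
      rw [levyTest, levyTest, e1, ← abs_neg]
      refine le_trans (le_of_eq ?_) (h1.trans (le_of_eq ?_))
      · congr 1; ring
      · rw [div_pow]; ring
    · rw [← div_div]
      refine div_le_div_of_nonneg_right ?_ hk0.le
      rw [le_div_iff₀ (by positivity)]
      have h2 : δ ^ 2 ≤ 1 := pow_le_one₀ hδ.le hδ1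
      have e1 : (2 * (2 / δ) ^ 2 + 8 * (4 / δ ^ 2 + 1) ^ 2) * δ ^ 4
          = 8 * δ ^ 2 + 8 * (4 + δ ^ 2) ^ 2 := by field_simp; ring
      rw [e1]
      nlinarith [sq_nonneg δ]
  -- The cutoff moves the mean by at most `δ / 2` and is inactive when `|b| = k`. A deviation `δ` of
  -- `T` on the slice therefore forces a deviation `δ / 2` of `h`.
  have hmean : |bernoulliMean p (Finset.range n) T - bernoulliMean p (Finset.range n) h|
      ≤ δ / 2 := by
    have e1 : bernoulliMean p (Finset.range n) T = bernoulliMean p (Finset.range n) h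
        + bernoulliMean p (Finset.range n) (fun b => (1 - cardCutoff k b) * T b) := by
      rw [← bernoulliMean_add]
      exact bernoulliMean_congr fun b _ => by rw [hh]; ring
    have h01 : ∀ b, (1 - cardCutoff k b) * T b ∈ Set.Icc (0 : ℝ) 1 := fun b => by
      have h1 := cardCutoff_mem_Icc k b
      exact ⟨mul_nonneg (sub_nonneg.2 h1.2) (hT1 b).1,
        mul_le_one₀ (by linarith [h1.1]) (hT1 b).1 (hT1 b).2⟩
    have h2 := bernoulliMean_mem_Icc hp0 hp1 (s := Finset.range n) h01
    rw [e1, add_sub_cancel_left, abs_of_nonneg h2.1]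
    refine (bernoulliMean_card_gt_le hp0 hp1 hpn (fun b => (h01 b).2) fun b hb => ?_).trans hkδ
    rw [cardCutoff_eq_one hk hb, sub_self, zero_mul]
  refine (sliceMeasure_le_bernoulliMean hk hkn _).trans ?_
  have htail := bernoulliMean_tail_le hp0 hp1 (by positivity) hV (half_pos hδ)
  have e2 : (δ / 2) ^ 2 / (4 * (208 / (δ ^ 4 * k))) = k * δ ^ 6 / 3328 := by
    field_simp; norm_num
  rw [e2] at htail
  refine (mul_le_mul_of_nonneg_left (le_trans (bernoulliMean_mono hp0 hp1 fun b _ => ?_) htail)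
    (by positivity)).trans (le_of_eq (by ring))
  split_ifs with hb hc hc
  · exact le_rfl
  · refine absurd ?_ hc
    have hb1 : h b = T b := by
      simp only [hh]
      rw [cardCutoff_eq_one hk (by have := hb.1; omega), one_mul]
    rw [hb1]
    have h4 : δ < |T b - bernoulliMean p (Finset.range n) T| := hb.2
    have h5 := abs_sub_le (T b) (bernoulliMean p (Finset.range n) h)
      (bernoulliMean p (Finset.range n) T)
    rw [abs_sub_comm (bernoulliMean p (Finset.range n) h)] at h5
    linarith
  · exact zero_le_one
  · exact le_rfl

/-- The distribution function of the scaled sum over a random set of independently selected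
indices. -/
noncomputable def bernoulliDistFun {Ω : Type*} [MeasurableSpace Ω] (P : Measure Ω)
    (X : ℕ → Ω → ℝ) (p : ℝ) (n k : ℕ) (x : ℝ) : ℝ :=
  bernoulliMean p (Finset.range n) (fun b => distFun P (scaledSum X k b) x)

lemma bernoulliDistFun_mem_Icc {p : ℝ} (hp : 0 ≤ p) (hp1 : p ≤ 1) (n k : ℕ) (x : ℝ) :
    bernoulliDistFun P X p n k x ∈ Set.Icc (0 : ℝ) 1 :=
  bernoulliMean_mem_Icc hp hp1 fun _ => distFun_mem_Icc P _ x

lemma monotone_bernoulliDistFun {p : ℝ} (hp : 0 ≤ p) (hp1 : p ≤ 1) (n k : ℕ) :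
    Monotone (bernoulliDistFun P X p n k) :=
  fun _ _ h => bernoulliMean_mono hp hp1 fun _ _ => monotone_distFun P _ h

/-- For most `τ` the distribution of `S_τ` is close to that of the scaled sum over a random set of
independently selected indices. -/
theorem sliceMeasure_levy_gt_le (hX : ∀ j, Measurable (X j))
    (hXX : ∀ i j, ∫ ω, X i ω * X j ω ∂P = if i = j then 1 else 0)
    {n k : ℕ} (hk : 1 ≤ k) (hkn : k ≤ n) {δ : ℝ} (hδ : 0 < δ) (hδ1 : δ ≤ 1)
    (hkδ : (Real.exp 1 / 4) ^ k ≤ δ / 2) :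
    sliceMeasure n k {τ | ¬ ∀ x, distFun P (normalizedSum X τ) x
          ≤ bernoulliDistFun P X (k / n) n k (x + 2 * δ) + 2 * δ
        ∧ bernoulliDistFun P X (k / n) n k x
          ≤ distFun P (normalizedSum X τ) (x + 2 * δ) + 2 * δ}
      ≤ 64 * √k / δ ^ 2 * Real.exp (-(k * δ ^ 6 / 3328)) := by
  have hn0 : (0 : ℝ) < n := by exact_mod_cast (by omega : 0 < n)
  set p : ℝ := k / n with hp
  have hp0 : 0 ≤ p := by positivity
  have hp1 : p ≤ 1 := div_le_one_of_le₀ (by exact_mod_cast hkn) hn0.le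
  set N : ℕ := ⌈2 / δ ^ 2⌉₊ + 4 with hN
  have hN1 : 2 / δ ^ 2 + 4 ≤ N := by
    rw [hN]; push_cast; linarith [Nat.le_ceil (2 / δ ^ 2)]
  have hN2 : (N : ℝ) ≤ 8 / δ ^ 2 := by
    rw [hN]; push_cast
    have h1 := Nat.ceil_lt_add_one (a := 2 / δ ^ 2) (by positivity)
    have h2 : 1 ≤ 1 / δ ^ 2 := one_le_one_div (by positivity) (pow_le_one₀ hδ.le hδ1)
    have e1 : 2 / δ ^ 2 = 2 * (1 / δ ^ 2) := by ring
    have e2 : 8 / δ ^ 2 = 8 * (1 / δ ^ 2) := by ring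
    rw [e2]
    rw [e1] at h1 ⊢
    linarith
  refine (sliceMeasure_le_sum (N := N) (B := fun i => {τ | τ.card = k ∧
      δ < |(∫ ω, levyTest (-(1 / δ) - δ + i * δ) δ (scaledSum X k τ ω) ∂P)
        - bernoulliMean p (Finset.range n)
          (fun b => ∫ ω, levyTest (-(1 / δ) - δ + i * δ) δ (scaledSum X k b ω) ∂P)|})
      fun τ hτ hbad => ?_).trans ?_
  · have hcard : τ.card = k := (Finset.mem_powersetCard.1 hτ).2
    have hS : normalizedSum X τ = scaledSum X k τ := by
      funext ω; rw [normalizedSum, scaledSum, hcard]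
    by_contra hcon
    push Not at hcon
    have hclose : ∀ i < N, |(∫ ω, levyTest (-(1 / δ) - δ + i * δ) δ (scaledSum X k τ ω) ∂P)
        - bernoulliMean p (Finset.range n)
          (fun b => ∫ ω, levyTest (-(1 / δ) - δ + i * δ) δ (scaledSum X k b ω) ∂P)| ≤ δ := by
      intro i hi
      have := hcon i hi
      simpa [hcard] using this
    have hlow : ∀ x, bernoulliDistFun P X p n k x ≤ bernoulliMean p (Finset.range n)
        (fun b => ∫ ω, levyTest x δ (scaledSum X k b ω) ∂P) := fun x =>
      bernoulliMean_mono hp0 hp1 fun b _ =>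
        distFun_le_integral_levyTest (measurable_scaledSum hX k b) x hδ
    have hup : ∀ x, bernoulliMean p (Finset.range n)
        (fun b => ∫ ω, levyTest x δ (scaledSum X k b ω) ∂P)
        ≤ bernoulliDistFun P X p n k (x + δ) := fun x =>
      bernoulliMean_mono hp0 hp1 fun b _ =>
        integral_levyTest_le_distFun (measurable_scaledSum hX k b) x hδ
    have htail := distFun_tail_le (memLp_scaledSum hX hXX k τ) (measurable_scaledSum hX k τ)
      (integral_scaledSum_sq hX hXX hk hcard).le hδ hδ1
    refine hbad fun x => ?_
    rw [hS]
    refine forall_le_of_grid (monotone_distFun P _) (monotone_bernoulliDistFun hp0 hp1 n k)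
      (distFun_mem_Icc P _) (bernoulliDistFun_mem_Icc hp0 hp1 n k) hδ htail.1 htail.2 hN1
      (fun i hi => ?_) (fun i hi => ?_) x
    · have h1 := (abs_le.1 (hclose i hi)).2
      have h2 := distFun_le_integral_levyTest (P := P) (measurable_scaledSum hX k τ)
        (-(1 / δ) - δ + i * δ) hδ
      have h3 := hup (-(1 / δ) - δ + i * δ)
      linarith
    · have h1 := (abs_le.1 (hclose i hi)).1
      have h2 := integral_levyTest_le_distFun (P := P) (measurable_scaledSum hX k τ)
        (-(1 / δ) - δ + i * δ) hδ
      have h3 := hlow (-(1 / δ) - δ + i * δ)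
      linarith
  · refine (Finset.sum_le_sum fun i _ =>
      sliceMeasure_levyTest_le hX hXX hk hkn hδ hδ1 hkδ _).trans ?_
    rw [Finset.sum_const, Finset.card_range, nsmul_eq_mul]
    calc (N : ℝ) * (8 * √k * Real.exp (-(k * δ ^ 6 / 3328)))
        ≤ 8 / δ ^ 2 * (8 * √k * Real.exp (-(k * δ ^ 6 / 3328))) :=
          mul_le_mul_of_nonneg_right hN2 (by positivity)
      _ = _ := by ring

end Slice

/-! ### Comparison of Bernoulli and normal characteristic functions. -/

section CharFun

/-- Replace the factors one at a time; all the others have modulus at most one. -/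
lemma norm_prod_sub_prod_le_sum {ι : Type*} (s : Finset ι) {a w : ι → ℂ}
    (ha : ∀ j ∈ s, ‖a j‖ ≤ 1) (hw : ∀ j ∈ s, ‖w j‖ ≤ 1) :
    ‖∏ j ∈ s, a j - ∏ j ∈ s, w j‖ ≤ ∑ j ∈ s, ‖a j - w j‖ := by
  classical
  induction s using Finset.induction_on with
  | empty => simp
  | insert i s hi ih =>
    rw [Finset.prod_insert hi, Finset.prod_insert hi, Finset.sum_insert hi]
    have h1 : ‖∏ j ∈ s, w j‖ ≤ 1 := by
      rw [norm_prod]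
      exact Finset.prod_le_one (fun _ _ => norm_nonneg _)
        fun j hj => hw j (Finset.mem_insert_of_mem hj)
    have h2 := ih (fun j hj => ha j (Finset.mem_insert_of_mem hj))
      fun j hj => hw j (Finset.mem_insert_of_mem hj)
    have e : a i * ∏ j ∈ s, a j - w i * ∏ j ∈ s, w j
        = a i * (∏ j ∈ s, a j - ∏ j ∈ s, w j) + (a i - w i) * ∏ j ∈ s, w j := by ring
    rw [e]
    refine (norm_add_le _ _).trans ?_
    rw [norm_mul, norm_mul]
    have h3 := mul_le_mul (ha i (Finset.mem_insert_self i s)) h2 (norm_nonneg _) zero_le_one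
    have h4 := mul_le_mul_of_nonneg_left h1 (norm_nonneg (a i - w i))
    linarith

lemma abs_exp_neg_sub_one_le {x : ℝ} (hx : 0 ≤ x) : |Real.exp (-x) - 1| ≤ x := by
  rw [abs_le]
  have h1 := Real.add_one_le_exp (-x)
  have h2 := Real.exp_le_one_iff.2 (neg_nonpos.2 hx)
  constructor <;> linarith

/-- The characteristic function of a scaled Bernoulli variable compared with that of a normal
variable. -/
lemma norm_bernoulli_charFun_sub_le {p : ℝ} (hp : 0 ≤ p) (hp1 : p ≤ 1) (y : ℝ) :
    ‖((p : ℂ) * Complex.exp (y * Complex.I) + ((1 - p : ℝ) : ℂ))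
        - Complex.exp ((p * y : ℝ) * Complex.I) * (Real.exp (-(p * y ^ 2 / 2)) : ℂ)‖
      ≤ 21 * (p * |y| ^ 3) + 2 * (p ^ 2 * y ^ 2) := by
  have hy0 := abs_nonneg y
  have hysq : y ^ 2 = |y| ^ 2 := (sq_abs y).symm
  have hnp : ‖(p : ℂ)‖ = p := by rw [Complex.norm_real, Real.norm_of_nonneg hp]
  -- For small `y` both sides agree to second order except for a term of size `p² y²`, since the
  -- normal factor has variance `p` and not `p (1 - p)`. For large `y`, crude bounds suffice, as
  -- `|y|` and `y²` are dominated by `|y|³`.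
  rcases le_or_gt |y| (1 / 2) with hy | hy
  · set z : ℂ := ((p * y : ℝ) * Complex.I) + ((-(p * y ^ 2 / 2) : ℝ) : ℂ) with hz
    have hw : Complex.exp ((p * y : ℝ) * Complex.I) * (Real.exp (-(p * y ^ 2 / 2)) : ℂ)
        = Complex.exp z := by rw [hz, Complex.exp_add, Complex.ofReal_exp]
    have hzn : ‖z‖ ≤ 5 / 4 * (p * |y|) := by
      refine (norm_add_le _ _).trans ?_
      rw [norm_mul, Complex.norm_I, mul_one, Complex.norm_real, Complex.norm_real, norm_neg,
        Real.norm_eq_abs, Real.norm_eq_abs, abs_mul, abs_of_nonneg hp,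
        abs_of_nonneg (by positivity : 0 ≤ p * y ^ 2 / 2), hysq]
      nlinarith [mul_nonneg hp hy0, mul_le_mul_of_nonneg_left hy (mul_nonneg hp hy0)]
    have hz1 : ‖z‖ ≤ 1 := by
      refine hzn.trans ?_
      nlinarith [mul_le_mul hp1 hy hy0 zero_le_one]
    have h1 := Complex.norm_exp_sub_one_sub_id_le hz1
    have h2 : ‖z‖ ^ 2 ≤ 2 * (p ^ 2 * y ^ 2) := by
      refine (pow_le_pow_left₀ (norm_nonneg _) hzn 2).trans ?_
      rw [hysq]
      nlinarith [sq_nonneg (p * |y|)]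
    have hyI : ‖(y * Complex.I : ℂ)‖ = |y| := by simp
    have h3 := Complex.exp_bound (x := y * Complex.I) (by rw [hyI]; linarith)
      (n := 3) (by norm_num)
    rw [hyI] at h3
    have h4 : ‖Complex.exp (y * Complex.I) - (1 + y * Complex.I - y ^ 2 / 2)‖ ≤ |y| ^ 3 := by
      have e1 : ∑ m ∈ Finset.range 3, (y * Complex.I : ℂ) ^ m / (m.factorial : ℂ)
          = 1 + y * Complex.I - y ^ 2 / 2 := by
        simp only [Finset.sum_range_succ, Finset.sum_range_zero, Nat.factorial]
        rw [mul_pow (y : ℂ) Complex.I 2, Complex.I_sq]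
        push_cast
        ring
      rw [e1] at h3
      refine h3.trans ?_
      have : (0 : ℝ) ≤ |y| ^ 3 := by positivity
      norm_num [Nat.factorial]
      linarith
    rw [hw]
    have e2 : ((p : ℂ) * Complex.exp (y * Complex.I) + ((1 - p : ℝ) : ℂ)) - Complex.exp z
        = p * (Complex.exp (y * Complex.I) - (1 + y * Complex.I - y ^ 2 / 2))
          - (Complex.exp z - 1 - z) := by
      rw [hz]; push_cast; ring
    rw [e2]
    refine (norm_sub_le _ _).trans ?_
    rw [norm_mul, hnp]
    have := mul_le_mul_of_nonneg_left h4 hp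
    have : 0 ≤ p * |y| ^ 3 := by positivity
    linarith
  · have e1 : ((p : ℂ) * Complex.exp (y * Complex.I) + ((1 - p : ℝ) : ℂ))
        - Complex.exp ((p * y : ℝ) * Complex.I) * (Real.exp (-(p * y ^ 2 / 2)) : ℂ)
        = p * (Complex.exp (y * Complex.I) - 1)
          - (Complex.exp ((p * y : ℝ) * Complex.I) - 1)
          - Complex.exp ((p * y : ℝ) * Complex.I)
            * ((Real.exp (-(p * y ^ 2 / 2)) - 1 : ℝ) : ℂ) := by push_cast; ring
    have h1 : ∀ u : ℝ, ‖Complex.exp (u * Complex.I) - 1‖ ≤ |u| := fun u => by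
      rw [mul_comm]; exact Real.norm_exp_I_mul_ofReal_sub_one_le
    have h2 := abs_exp_neg_sub_one_le (by positivity : 0 ≤ p * y ^ 2 / 2)
    rw [e1]
    refine (norm_sub_le _ _).trans ((add_le_add_left (norm_sub_le _ _) _).trans ?_)
    rw [norm_mul, norm_mul, hnp, Complex.norm_exp_ofReal_mul_I, one_mul, Complex.norm_real,
      Real.norm_eq_abs]
    have h3 := mul_le_mul_of_nonneg_left (h1 y) hp
    have h4 := h1 (p * y)
    rw [abs_mul, abs_of_nonneg hp] at h4
    have h5 : |y| ≤ 4 * |y| ^ 3 := by nlinarith [mul_nonneg hy0 (sub_nonneg.2 hy.le)]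
    have h6 : |y| ^ 2 ≤ 2 * |y| ^ 3 := by nlinarith [mul_nonneg (sq_nonneg |y|) (sub_nonneg.2 hy.le)]
    rw [hysq] at h2 ⊢
    have h7 := mul_le_mul_of_nonneg_left h5 hp
    have h8 := mul_le_mul_of_nonneg_left h6 hp
    have : 0 ≤ p * |y| ^ 3 := by positivity
    have : 0 ≤ p ^ 2 * |y| ^ 2 := by positivity
    linarith

end CharFun

/-! ### Characteristic function of the randomly selected sum. -/

section Mixture

/-- The law of the scaled sum over a random set of independently selected indices. -/
noncomputable def bernoulliLaw {Ω : Type*} [MeasurableSpace Ω] (P : Measure Ω)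
    (X : ℕ → Ω → ℝ) (p : ℝ) (n k : ℕ) : Measure ℝ :=
  ∑ b ∈ (Finset.range n).powerset,
    ENNReal.ofReal (bernoulliWeight p (Finset.range n) b) • P.map (scaledSum X k b)

variable {Ω : Type*} [MeasurableSpace Ω] {P : Measure Ω} [IsProbabilityMeasure P] {X : ℕ → Ω → ℝ}

lemma isProbabilityMeasure_bernoulliLaw (hX : ∀ j, Measurable (X j)) {p : ℝ} (hp : 0 ≤ p)
    (hp1 : p ≤ 1) (n k : ℕ) : IsProbabilityMeasure (bernoulliLaw P X p n k) := by
  constructor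
  have h1 : ∀ b, P.map (scaledSum X k b) Set.univ = 1 := fun b => by
    have := Measure.isProbabilityMeasure_map (μ := P) (measurable_scaledSum hX k b).aemeasurable
    exact measure_univ
  simp only [bernoulliLaw, Measure.coe_finsetSum, Finset.sum_apply, Measure.smul_apply, h1,
    smul_eq_mul, mul_one]
  rw [← ENNReal.ofReal_sum_of_nonneg fun b _ => bernoulliWeight_nonneg hp hp1 _ b,
    sum_bernoulliWeight, ENNReal.ofReal_one]

lemma bernoulliLaw_real_Iic (hX : ∀ j, Measurable (X j)) {p : ℝ} (hp : 0 ≤ p)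
    (hp1 : p ≤ 1) (n k : ℕ) (x : ℝ) :
    (bernoulliLaw P X p n k).real (Set.Iic x) = bernoulliDistFun P X p n k x := by
  rw [measureReal_def, bernoulliLaw, Measure.coe_finsetSum, Finset.sum_apply,
    ENNReal.toReal_sum]
  · refine Finset.sum_congr rfl fun b _ => ?_
    rw [Measure.smul_apply, smul_eq_mul, ENNReal.toReal_mul,
      ENNReal.toReal_ofReal (bernoulliWeight_nonneg hp hp1 _ b),
      Measure.map_apply (measurable_scaledSum hX k b) measurableSet_Iic]
    rfl
  · intro b _
    rw [Measure.smul_apply, smul_eq_mul,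
      Measure.map_apply (measurable_scaledSum hX k b) measurableSet_Iic]
    exact ENNReal.mul_ne_top ENNReal.ofReal_ne_top (measure_ne_top _ _)

lemma integrable_cexp_mul_I {Y : Ω → ℝ} (hY : Measurable Y) :
    Integrable (fun ω => Complex.exp (Y ω * Complex.I)) P := by
  refine Integrable.of_bound (C := 1) ?_ (ae_of_all _ fun ω => ?_)
  · exact (Complex.measurable_exp.comp ((Complex.measurable_ofReal.comp hY).mul_const _)).aestronglyMeasurable
  · rw [Complex.norm_exp_ofReal_mul_I]

/-- For fixed `ω` the selections are independent, so averaging over `b` factorizes; no independence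
of the `X j` is involved. -/
lemma charFun_bernoulliLaw (hX : ∀ j, Measurable (X j)) {p : ℝ} (hp : 0 ≤ p)
    (hp1 : p ≤ 1) (n k : ℕ) (t : ℝ) :
    charFun (bernoulliLaw P X p n k) t = ∫ ω, ∏ j ∈ Finset.range n,
      ((p : ℂ) * Complex.exp ((t * X j ω / √k : ℝ) * Complex.I) + ((1 - p : ℝ) : ℂ)) ∂P := by
  have hS : ∀ b, Measurable (fun ω => t * scaledSum X k b ω) := fun b =>
    (measurable_scaledSum hX k b).const_mul t
  have hcont : Continuous (fun x : ℝ => Complex.exp (t * x * Complex.I)) := by fun_prop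
  have hint : ∀ b, ∫ x, Complex.exp (t * x * Complex.I) ∂(P.map (scaledSum X k b))
      = ∫ ω, Complex.exp ((t * scaledSum X k b ω : ℝ) * Complex.I) ∂P := fun b => by
    rw [integral_map (measurable_scaledSum hX k b).aemeasurable hcont.aestronglyMeasurable]
    push_cast; rfl
  rw [charFun_apply_real, bernoulliLaw, integral_finsetSum_measure]
  · simp only [integral_smul_measure, hint]
    have e : ∀ ω, ∏ j ∈ Finset.range n,
        ((p : ℂ) * Complex.exp ((t * X j ω / √k : ℝ) * Complex.I) + ((1 - p : ℝ) : ℂ))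
        = ∑ b ∈ (Finset.range n).powerset, (bernoulliWeight p (Finset.range n) b : ℂ)
          * Complex.exp ((t * scaledSum X k b ω : ℝ) * Complex.I) := fun ω => by
      refine (sum_bernoulliWeight_mul_prod (𝕜 := ℂ) p (Finset.range n) _).symm.trans ?_
      refine Finset.sum_congr rfl fun b _ => ?_
      rw [← Complex.exp_sum, ← Finset.sum_mul, scaledSum]
      congr 3
      rw [← Complex.ofReal_sum, ← Finset.sum_div, ← Finset.mul_sum, mul_div_assoc]
    simp only [e]
    rw [integral_finsetSum _ fun b _ => (integrable_cexp_mul_I (hS b)).const_mul _]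
    refine Finset.sum_congr rfl fun b _ => ?_
    rw [integral_const_mul, ENNReal.toReal_ofReal (bernoulliWeight_nonneg hp hp1 _ b),
      Complex.real_smul]
  · intro b _
    refine Integrable.smul_measure ?_ ENNReal.ofReal_ne_top
    have := Measure.isProbabilityMeasure_map (μ := P) (measurable_scaledSum hX k b).aemeasurable
    refine Integrable.of_bound (C := 1) hcont.aestronglyMeasurable (ae_of_all _ fun x => ?_)
    rw [← Complex.ofReal_mul, Complex.norm_exp_ofReal_mul_I]

/-- From `E (∑ X_j)² = n` and `|x| ≤ (1 + x²) / 2`. It makes the random phase of order `√(k / n)`.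
-/
lemma integral_abs_sum_le (hX : ∀ j, Measurable (X j))
    (hXX : ∀ i j, ∫ ω, X i ω * X j ω ∂P = if i = j then 1 else 0) {n : ℕ} (hn : 1 ≤ n) :
    ∫ ω, |∑ j ∈ Finset.range n, X j ω| ∂P ≤ √n := by
  have h1 := integral_scaledSum_sq hX hXX hn (Finset.card_range n)
  have h2 := memLp_scaledSum hX hXX n (Finset.range n)
  have hn0 : (0 : ℝ) < √n := Real.sqrt_pos.2 (by exact_mod_cast hn)
  have h3 : ∫ ω, |scaledSum X n (Finset.range n) ω| ∂P ≤ 1 := by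
    calc ∫ ω, |scaledSum X n (Finset.range n) ω| ∂P
        ≤ ∫ ω, (1 / 2 + 1 / 2 * scaledSum X n (Finset.range n) ω ^ 2) ∂P := by
          refine integral_mono (h2.integrable one_le_two).abs
            ((integrable_const _).add (h2.integrable_sq.const_mul _)) fun ω => ?_
          have := sq_nonneg (|scaledSum X n (Finset.range n) ω| - 1)
          have := sq_abs (scaledSum X n (Finset.range n) ω)
          simp only
          nlinarith
      _ = 1 := by
          rw [integral_add (integrable_const _) (h2.integrable_sq.const_mul _),
            integral_const_mul, h1]
          simp
          norm_num
  have h4 : ∀ ω, |∑ j ∈ Finset.range n, X j ω| = √n * |scaledSum X n (Finset.range n) ω| := by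
    intro ω
    rw [scaledSum, abs_div, abs_of_pos hn0]
    field_simp
  simp only [h4]
  rw [integral_const_mul]
  nlinarith

/-- A quantitative comparison of the characteristic function of `bernoulliLaw` with that of a
mixture of normal distributions. -/
lemma norm_charFun_bernoulliLaw_sub_le (hX : ∀ j, Measurable (X j))
    (hXX : ∀ i j, ∫ ω, X i ω * X j ω ∂P = if i = j then 1 else 0) {M : ℝ}
    (hX3 : ∀ j, Integrable (fun ω => |X j ω| ^ 3) P) (hM : ∀ j, ∫ ω, |X j ω| ^ 3 ∂P ≤ M)
    {n k : ℕ} (hk : 1 ≤ k) (hkn : k ≤ n) (t : ℝ) :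
    ‖charFun (bernoulliLaw P X (k / n) n k) t
        - ((∫ ω, Real.exp (-(t ^ 2 / 2 * ((∑ j ∈ Finset.range n, X j ω ^ 2) / n))) ∂P : ℝ) : ℂ)‖
      ≤ 21 * |t| ^ 3 * M / √k + 2 * t ^ 2 * (k / n) + |t| * √(k / n) := by
  have hk0 : (0 : ℝ) < k := by exact_mod_cast hk
  have hn1 : 1 ≤ n := hk.trans hkn
  have hn0 : (0 : ℝ) < n := by exact_mod_cast hn1
  have hsk : (0 : ℝ) < √k := Real.sqrt_pos.2 hk0
  set p : ℝ := k / n with hp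
  have hp0 : 0 ≤ p := by positivity
  have hp1 : p ≤ 1 := div_le_one_of_le₀ (by exact_mod_cast hkn) hn0.le
  set s := Finset.range n with hs
  set a : ℕ → Ω → ℂ := fun j ω =>
    (p : ℂ) * Complex.exp ((t * X j ω / √k : ℝ) * Complex.I) + ((1 - p : ℝ) : ℂ) with ha
  set w : ℕ → Ω → ℂ := fun j ω => Complex.exp ((p * (t * X j ω / √k) : ℝ) * Complex.I)
    * (Real.exp (-(p * (t * X j ω / √k) ^ 2 / 2)) : ℂ) with hw
  set W : Ω → ℝ := fun ω => Real.exp (-(t ^ 2 / 2 * ((∑ j ∈ s, X j ω ^ 2) / n))) with hW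
  have hWm : Measurable W := by
    have : Measurable fun ω => ∑ j ∈ s, X j ω ^ 2 :=
      Finset.measurable_sum s fun j _ => (hX j).pow_const 2
    exact (((this.div_const _).const_mul _).neg).exp
  have hW1 : ∀ ω, |W ω| ≤ 1 := fun ω => by
    rw [abs_of_pos (Real.exp_pos _), Real.exp_le_one_iff, neg_nonpos]
    have : 0 ≤ ∑ j ∈ s, X j ω ^ 2 := Finset.sum_nonneg fun j _ => sq_nonneg _
    positivity
  have hWi : Integrable W P := Integrable.of_bound hWm.aestronglyMeasurable 1 (ae_of_all _ hW1)
  have ha1 : ∀ j ω, ‖a j ω‖ ≤ 1 := fun j ω => by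
    refine (norm_add_le _ _).trans ?_
    rw [norm_mul, Complex.norm_exp_ofReal_mul_I, Complex.norm_real, Complex.norm_real,
      Real.norm_of_nonneg hp0, Real.norm_of_nonneg (sub_nonneg.2 hp1)]
    linarith
  have hw1 : ∀ j ω, ‖w j ω‖ ≤ 1 := fun j ω => by
    rw [norm_mul, Complex.norm_exp_ofReal_mul_I, Complex.norm_real,
      Real.norm_of_nonneg (Real.exp_pos _).le, one_mul, Real.exp_le_one_iff, neg_nonpos]
    positivity
  have ham : ∀ j, Measurable (a j) := fun j =>
    ((Complex.measurable_exp.comp ((Complex.measurable_ofReal.comp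
      (((hX j).const_mul t).div_const _)).mul_const _)).const_mul _).add_const _
  have hai : Integrable (fun ω => ∏ j ∈ s, a j ω) P := by
    refine Integrable.of_bound (C := 1)
      (Finset.measurable_prod s fun j _ => ham j).aestronglyMeasurable (ae_of_all _ fun ω => ?_)
    rw [norm_prod]
    exact Finset.prod_le_one (fun _ _ => norm_nonneg _) fun j _ => ha1 j ω
  have hsum1 : ∀ ω, ‖∏ j ∈ s, a j ω - ∏ j ∈ s, w j ω‖
      ≤ ∑ j ∈ s, (21 * p * |t| ^ 3 / √k ^ 3 * |X j ω| ^ 3 + 2 * p ^ 2 * t ^ 2 / k * X j ω ^ 2) := by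
    intro ω
    refine (norm_prod_sub_prod_le_sum s (fun j _ => ha1 j ω) fun j _ => hw1 j ω).trans ?_
    refine Finset.sum_le_sum fun j _ => ?_
    refine (norm_bernoulli_charFun_sub_le hp0 hp1 (t * X j ω / √k)).trans (le_of_eq ?_)
    have e : (t * X j ω / √k) ^ 2 = t ^ 2 * X j ω ^ 2 / k := by
      rw [div_pow, mul_pow, Real.sq_sqrt hk0.le]
    rw [e, abs_div, abs_mul, abs_of_pos hsk]
    ring
  -- The normal factors multiply to a phase driven by `∑ X_j` and the damping `W`, which depends
  -- only on the empirical second moment.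
  have hprodw : ∀ ω, ∏ j ∈ s, w j ω
      = Complex.exp ((t * √k / n * ∑ j ∈ s, X j ω : ℝ) * Complex.I) * (W ω : ℂ) := by
    intro ω
    simp only [hw, hW]
    rw [Finset.prod_mul_distrib, ← Complex.exp_sum, ← Finset.sum_mul, ← Complex.ofReal_sum,
      ← Complex.ofReal_prod, ← Real.exp_sum]
    have e1 : ∑ j ∈ s, p * (t * X j ω / √k) = t * √k / n * ∑ j ∈ s, X j ω := by
      rw [Finset.mul_sum]
      refine Finset.sum_congr rfl fun j _ => ?_
      rw [hp]
      field_simp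
      rw [Real.sq_sqrt hk0.le]
      ring
    have e2 : ∑ j ∈ s, -(p * (t * X j ω / √k) ^ 2 / 2)
        = -(t ^ 2 / 2 * ((∑ j ∈ s, X j ω ^ 2) / n)) := by
      rw [Finset.sum_div, Finset.mul_sum, ← Finset.sum_neg_distrib]
      refine Finset.sum_congr rfl fun j _ => ?_
      rw [div_pow, Real.sq_sqrt hk0.le, hp]
      field_simp
    rw [e1, e2]
  have hsum2 : ∀ ω, ‖∏ j ∈ s, w j ω - (W ω : ℂ)‖ ≤ |t| * √k / n * |∑ j ∈ s, X j ω| := by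
    intro ω
    have e1 : Complex.exp ((t * √k / n * ∑ j ∈ s, X j ω : ℝ) * Complex.I) * (W ω : ℂ) - (W ω : ℂ)
        = (Complex.exp ((t * √k / n * ∑ j ∈ s, X j ω : ℝ) * Complex.I) - 1) * (W ω : ℂ) := by ring
    rw [hprodw, e1, norm_mul, Complex.norm_real, Real.norm_eq_abs]
    have h1 : ‖Complex.exp ((t * √k / n * ∑ j ∈ s, X j ω : ℝ) * Complex.I) - 1‖
        ≤ |t * √k / n * ∑ j ∈ s, X j ω| := by
      rw [mul_comm]; exact Real.norm_exp_I_mul_ofReal_sub_one_le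
    have h2 := mul_le_mul h1 (hW1 ω) (abs_nonneg _) (abs_nonneg _)
    rw [abs_mul, abs_div, abs_mul, abs_of_pos hsk, abs_of_pos hn0] at h2
    linarith
  have hX2 := memLp_two_of_orthonormal hX hXX
  have i0 : ∀ j, Integrable (fun ω => 21 * p * |t| ^ 3 / √k ^ 3 * |X j ω| ^ 3
      + 2 * p ^ 2 * t ^ 2 / k * X j ω ^ 2) P := fun j =>
    ((hX3 j).const_mul _).add ((hX2 j).integrable_sq.const_mul _)
  have i1 : Integrable (fun ω => ∑ j ∈ s, (21 * p * |t| ^ 3 / √k ^ 3 * |X j ω| ^ 3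
      + 2 * p ^ 2 * t ^ 2 / k * X j ω ^ 2)) P :=
    integrable_finsetSum _ fun j _ => i0 j
  have i2 : Integrable (fun ω => |t| * √k / n * |∑ j ∈ s, X j ω|) P :=
    (((memLp_finsetSum s fun i _ => hX2 i).integrable one_le_two).abs).const_mul _
  have hsq : ∀ j, ∫ ω, X j ω ^ 2 ∂P = 1 := fun j => by
    have := hXX j j
    rw [if_pos rfl] at this
    simpa [sq] using this
  have hM0 : 0 ≤ 21 * p * |t| ^ 3 / √k ^ 3 := by positivity
  have hsk3 : √(k : ℝ) ^ 3 = k * √k := by rw [pow_succ, Real.sq_sqrt hk0.le]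
  have b1 : ∫ ω, ∑ j ∈ s, (21 * p * |t| ^ 3 / √k ^ 3 * |X j ω| ^ 3
      + 2 * p ^ 2 * t ^ 2 / k * X j ω ^ 2) ∂P
      ≤ 21 * |t| ^ 3 * M / √k + 2 * t ^ 2 * (k / n) := by
    rw [integral_finsetSum _ fun j _ => i0 j]
    calc ∑ j ∈ s, ∫ ω, (21 * p * |t| ^ 3 / √k ^ 3 * |X j ω| ^ 3
          + 2 * p ^ 2 * t ^ 2 / k * X j ω ^ 2) ∂P
        ≤ ∑ j ∈ s, (21 * p * |t| ^ 3 / √k ^ 3 * M + 2 * p ^ 2 * t ^ 2 / k) := by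
          refine Finset.sum_le_sum fun j _ => ?_
          rw [integral_add ((hX3 j).const_mul _) ((hX2 j).integrable_sq.const_mul _),
            integral_const_mul, integral_const_mul, hsq, mul_one]
          have := mul_le_mul_of_nonneg_left (hM j) hM0
          linarith
      _ = 21 * |t| ^ 3 * M / √k + 2 * t ^ 2 * (k / n) := by
          rw [Finset.sum_const, hs, Finset.card_range, nsmul_eq_mul, hsk3, hp]
          field_simp
  have b2 : ∫ ω, |t| * √k / n * |∑ j ∈ s, X j ω| ∂P ≤ |t| * √(k / n) := by
    rw [integral_const_mul]
    refine (mul_le_mul_of_nonneg_left (integral_abs_sum_le hX hXX hn1)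
      (by positivity)).trans (le_of_eq ?_)
    rw [Real.sqrt_div hk0.le]
    have := Real.sq_sqrt hn0.le
    have hsn : 0 < √(n : ℝ) := Real.sqrt_pos.2 hn0
    field_simp
    linear_combination |t| * this
  have e0 : charFun (bernoulliLaw P X p n k) t = ∫ ω, ∏ j ∈ s, a j ω ∂P :=
    charFun_bernoulliLaw hX hp0 hp1 n k t
  have hWi' : Integrable (fun ω => (W ω : ℂ)) P := hWi.ofReal
  rw [e0]
  change ‖_ - ((∫ ω, W ω ∂P : ℝ) : ℂ)‖ ≤ _
  rw [← integral_complex_ofReal, ← integral_sub hai hWi']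
  refine (norm_integral_le_of_norm_le (i1.add i2) (ae_of_all _ fun ω => ?_)).trans ?_
  · have e1 : ∏ j ∈ s, a j ω - (W ω : ℂ)
        = (∏ j ∈ s, a j ω - ∏ j ∈ s, w j ω) + (∏ j ∈ s, w j ω - (W ω : ℂ)) := by ring
    rw [e1]
    exact (norm_add_le _ _).trans (add_le_add (hsum1 ω) (hsum2 ω))
  · rw [integral_add' i1 i2]
    exact add_le_add b1 b2

end Mixture

/-! ### Weak convergence to the normal mixture in the sparse range. -/

section Convergence

/-- The Lévy distance tests only half-lines, whose `e`-thickenings lie in half-lines shifted by `e`.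
-/
lemma levyDistance_le_of_levyProkhorov_lt {μ ν : Measure ℝ} [IsProbabilityMeasure μ]
    [IsProbabilityMeasure ν] {e : ℝ} (he : 0 < e)
    (h : levyProkhorovEDist μ ν < ENNReal.ofReal e) :
    levyDistance (fun x => μ.real (Set.Iic x)) (fun x => ν.real (Set.Iic x)) ≤ e := by
  have key : ∀ (α β : Measure ℝ) [IsProbabilityMeasure α] [IsProbabilityMeasure β],
      levyProkhorovEDist α β < ENNReal.ofReal e → ∀ x,
      α.real (Set.Iic x) ≤ β.real (Set.Iic (x + e)) + e := by
    intro α β _ _ h x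
    have h1 := left_measure_le_of_levyProkhorovEDist_lt h (measurableSet_Iic (a := x))
    rw [ENNReal.toReal_ofReal he.le] at h1
    have h2 : Metric.thickening e (Set.Iic x) ⊆ Set.Iic (x + e) := by
      intro y hy
      obtain ⟨z, hz, hyz⟩ := Metric.mem_thickening_iff.1 hy
      have hz : z ≤ x := hz
      rw [Real.dist_eq] at hyz
      have := (abs_lt.1 hyz).2
      change y ≤ x + e
      linarith
    have h3 := h1.trans (add_le_add_left (measure_mono h2) _)
    have h4 := ENNReal.toReal_mono
      (ENNReal.add_ne_top.2 ⟨measure_ne_top _ _, ENNReal.ofReal_ne_top⟩) h3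
    rw [ENNReal.toReal_add (measure_ne_top _ _) ENNReal.ofReal_ne_top,
      ENNReal.toReal_ofReal he.le] at h4
    exact h4
  refine levyDistance_le he.le (key μ ν h) (key ν μ ?_)
  rwa [levyProkhorovEDist_comm]

/-- Weak convergence implies convergence of the distribution functions in the Lévy distance. -/
lemma tendsto_levyDistance {ι : Type*} {l : Filter ι} {μ : ι → ProbabilityMeasure ℝ}
    {ν : ProbabilityMeasure ℝ} (h : Tendsto μ l (𝓝 ν)) :
    Tendsto (fun i => levyDistance (fun x => (μ i : Measure ℝ).real (Set.Iic x))
      (fun x => (ν : Measure ℝ).real (Set.Iic x))) l (𝓝 0) := by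
  have h1 := (LevyProkhorov.probabilityMeasureHomeomorph (Ω := ℝ)).continuous.continuousAt.tendsto.comp h
  rw [tendsto_iff_edist_tendsto_0] at h1
  rw [Metric.tendsto_nhds]
  intro e he
  have h2 := h1.eventually (gt_mem_nhds (ENNReal.ofReal_pos.2 (half_pos he)))
  filter_upwards [h2] with i hi
  rw [Function.comp, LevyProkhorov.edist_probabilityMeasure_def] at hi
  have h3 := levyDistance_le_of_levyProkhorov_lt (half_pos he) hi
  rw [Real.dist_eq, sub_zero, abs_of_nonneg (levyDistance_nonneg _ _)]
  exact lt_of_le_of_lt h3 (half_lt_self he)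

/-- Allows convergence along `sparseRange` to be tested on sequences, where the continuity theorem
for characteristic functions is applied. -/
instance : sparseRange.IsCountablyGenerated := by
  unfold sparseRange; infer_instance

lemma tendsto_snd_sparseRange : Tendsto (fun p : ℕ × ℕ => p.2) sparseRange atTop :=
  tendsto_comap.mono_left inf_le_left

lemma tendsto_ratio_sparseRange :
    Tendsto (fun p : ℕ × ℕ => (p.1 : ℝ) / (p.2 : ℝ)) sparseRange atTop :=
  tendsto_comap.mono_left inf_le_right

lemma eventually_sparseRange : ∀ᶠ p : ℕ × ℕ in sparseRange, 1 ≤ p.2 ∧ p.2 ≤ p.1 := by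
  filter_upwards [tendsto_snd_sparseRange.eventually_ge_atTop 1,
    tendsto_ratio_sparseRange.eventually_ge_atTop 1] with p h1 h2
  refine ⟨h1, ?_⟩
  have : (0 : ℝ) < p.2 := by exact_mod_cast h1
  rw [le_div_iff₀ this, one_mul] at h2
  exact_mod_cast h2

lemma tendsto_fst_sparseRange : Tendsto (fun p : ℕ × ℕ => p.1) sparseRange atTop :=
  tendsto_atTop_mono' _ (eventually_sparseRange.mono fun _ h => h.2) tendsto_snd_sparseRange

lemma tendsto_inv_ratio_sparseRange :
    Tendsto (fun p : ℕ × ℕ => (p.2 : ℝ) / (p.1 : ℝ)) sparseRange (𝓝 0) := by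
  refine (tendsto_inv_atTop_zero.comp tendsto_ratio_sparseRange).congr fun p => ?_
  simp

/-- Fubini: given `R`, the product is centred normal with variance `R²`. -/
lemma charFun_mixedNormal {Ω' : Type*} [MeasurableSpace Ω'] {P' : Measure Ω'}
    [IsProbabilityMeasure P'] {R : Ω' → ℝ} (hR : Measurable R) (t : ℝ) :
    charFun ((P'.prod (gaussianReal 0 1)).map (fun q : Ω' × ℝ => R q.1 * q.2)) t
      = ((∫ ω, Real.exp (-(t ^ 2 / 2 * R ω ^ 2)) ∂P' : ℝ) : ℂ) := by
  have hm : Measurable (fun q : Ω' × ℝ => R q.1 * q.2) :=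
    (hR.comp measurable_fst).mul measurable_snd
  have hcont : Continuous (fun x : ℝ => Complex.exp (t * x * Complex.I)) := by fun_prop
  rw [charFun_apply_real, integral_map hm.aemeasurable hcont.aestronglyMeasurable,
    integral_prod, ← integral_complex_ofReal]
  · refine integral_congr_ae (ae_of_all _ fun ω => ?_)
    have h1 := charFun_gaussianReal (μ := 0) (v := 1) (t * R ω)
    rw [charFun_apply_real] at h1
    simp only
    have h2 : ∀ x : ℝ, (t : ℂ) * ((R ω * x : ℝ) : ℂ) * Complex.I
        = ((t * R ω : ℝ) : ℂ) * x * Complex.I := fun x => by push_cast; ring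
    simp only [h2, h1]
    push_cast
    congr 1
    ring
  · refine Integrable.of_bound (C := 1) (hcont.measurable.comp hm).aestronglyMeasurable
      (ae_of_all _ fun q => ?_)
    rw [← Complex.ofReal_mul, Complex.norm_exp_ofReal_mul_I]

/-- The selection probability `k / n`, truncated to `[0, 1]`. -/
noncomputable def selectionProb (n k : ℕ) : ℝ := min 1 (k / n : ℝ)

lemma selectionProb_nonneg (n k : ℕ) : 0 ≤ selectionProb n k :=
  le_min zero_le_one (by positivity)

lemma selectionProb_le_one (n k : ℕ) : selectionProb n k ≤ 1 := min_le_left _ _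

lemma selectionProb_eq {n k : ℕ} (hkn : k ≤ n) : selectionProb n k = k / n :=
  min_eq_right (div_le_one_of_le₀ (by exact_mod_cast hkn) (Nat.cast_nonneg _))

variable {Ω : Type*} [MeasurableSpace Ω] {P : Measure Ω} [IsProbabilityMeasure P]
  {Ω' : Type*} [MeasurableSpace Ω'] {P' : Measure Ω'} [IsProbabilityMeasure P']
  {X : ℕ → Ω → ℝ} {R : Ω' → ℝ}

lemma tendsto_integral_exp_neg (hX : ∀ j, Measurable (X j)) (hR : Measurable R)
    (hlim : TendstoInDistribution
      (fun (n : ℕ) (ω : Ω) => (∑ j ∈ Finset.range n, X j ω ^ 2) / (n : ℝ))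
      atTop (fun ω => R ω ^ 2) (fun _ => P) P') (t : ℝ) :
    Tendsto (fun n : ℕ =>
        ∫ ω, Real.exp (-(t ^ 2 / 2 * ((∑ j ∈ Finset.range n, X j ω ^ 2) / n))) ∂P)
      atTop (𝓝 (∫ ω, Real.exp (-(t ^ 2 / 2 * R ω ^ 2)) ∂P')) := by
  -- The absolute value keeps the test function bounded on the whole line and changes nothing on the
  -- nonnegative variables considered.
  have hcont : Continuous fun x : ℝ => Real.exp (-(t ^ 2 / 2 * |x|)) := by fun_prop
  let g : BoundedContinuousFunction ℝ ℝ :=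
    BoundedContinuousFunction.ofNormedAddCommGroup (fun x => Real.exp (-(t ^ 2 / 2 * |x|)))
      hcont 1 fun x => by
        rw [Real.norm_of_nonneg (Real.exp_pos _).le, Real.exp_le_one_iff, neg_nonpos]
        positivity
  have h1 := (ProbabilityMeasure.tendsto_iff_forall_integral_tendsto.1 hlim.tendsto) g
  have hV : ∀ n : ℕ, Measurable fun ω => (∑ j ∈ Finset.range n, X j ω ^ 2) / (n : ℝ) := fun n =>
    (Finset.measurable_sum _ fun j _ => (hX j).pow_const 2).div_const _
  have e1 : ∫ x, g x ∂(P'.map fun ω => R ω ^ 2) = ∫ ω, Real.exp (-(t ^ 2 / 2 * R ω ^ 2)) ∂P' := by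
    rw [integral_map (hR.pow_const 2).aemeasurable g.continuous.aestronglyMeasurable]
    refine integral_congr_ae (ae_of_all _ fun ω => ?_)
    change Real.exp (-(t ^ 2 / 2 * |R ω ^ 2|)) = _
    rw [abs_of_nonneg (sq_nonneg _)]
  have e2 : ∀ n : ℕ, ∫ x, g x ∂(P.map fun ω => (∑ j ∈ Finset.range n, X j ω ^ 2) / (n : ℝ))
      = ∫ ω, Real.exp (-(t ^ 2 / 2 * ((∑ j ∈ Finset.range n, X j ω ^ 2) / n))) ∂P := fun n => by
    rw [integral_map (hV n).aemeasurable g.continuous.aestronglyMeasurable]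
    refine integral_congr_ae (ae_of_all _ fun ω => ?_)
    change Real.exp (-(t ^ 2 / 2 * |(∑ j ∈ Finset.range n, X j ω ^ 2) / (n : ℝ)|)) = _
    rw [abs_of_nonneg (div_nonneg (Finset.sum_nonneg fun j _ => sq_nonneg _) (Nat.cast_nonneg _))]
  simp only [ProbabilityMeasure.coe_mk, e1, e2] at h1
  exact h1

/-- The distribution of the scaled sum over a random set of independently selected indices
converges to the mixed normal distribution in the sparse range. -/
theorem tendsto_levyDistance_bernoulliDistFun (hX : ∀ j, Measurable (X j))
    (hXX : ∀ i j, ∫ ω, X i ω * X j ω ∂P = if i = j then 1 else 0)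
    (hX3 : (⨆ j, ∫⁻ ω, ENNReal.ofReal (|X j ω| ^ 3) ∂P) < ⊤) (hR : Measurable R)
    (hlim : TendstoInDistribution
      (fun (n : ℕ) (ω : Ω) => (∑ j ∈ Finset.range n, X j ω ^ 2) / (n : ℝ))
      atTop (fun ω => R ω ^ 2) (fun _ => P) P') :
    Tendsto (fun p : ℕ × ℕ => levyDistance (bernoulliDistFun P X (selectionProb p.1 p.2) p.1 p.2)
      (mixedNormalDistFun P' R)) sparseRange (𝓝 0) := by
  have hm : Measurable (fun q : Ω' × ℝ => R q.1 * q.2) :=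
    (hR.comp measurable_fst).mul measurable_snd
  -- Truncating the selection probability gives a probability law for every pair, also when `k > n`.
  have hprob : ∀ p : ℕ × ℕ,
      IsProbabilityMeasure (bernoulliLaw P X (selectionProb p.1 p.2) p.1 p.2) := fun p =>
    isProbabilityMeasure_bernoulliLaw hX (selectionProb_nonneg _ _) (selectionProb_le_one _ _) _ _
  have hprob' := Measure.isProbabilityMeasure_map (μ := P'.prod (gaussianReal 0 1)) hm.aemeasurable
  let μ : ℕ × ℕ → ProbabilityMeasure ℝ := fun p => ⟨_, hprob p⟩
  let ν : ProbabilityMeasure ℝ := ⟨_, hprob'⟩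
  set M : ℝ := (⨆ j, ∫⁻ ω, ENNReal.ofReal (|X j ω| ^ 3) ∂P).toReal with hMdef
  have hfin : ∀ j, ∫⁻ ω, ENNReal.ofReal (|X j ω| ^ 3) ∂P ≠ ⊤ := fun j =>
    ((le_iSup (fun j => ∫⁻ ω, ENNReal.ofReal (|X j ω| ^ 3) ∂P) j).trans_lt hX3).ne
  have hmeas3 : ∀ j, Measurable fun ω => |X j ω| ^ 3 := fun j =>
    (continuous_abs.measurable.comp (hX j)).pow_const 3
  have hint3 : ∀ j, Integrable (fun ω => |X j ω| ^ 3) P := fun j =>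
    (lintegral_ofReal_ne_top_iff_integrable (hmeas3 j).aestronglyMeasurable
      (ae_of_all _ fun ω => by positivity)).1 (hfin j)
  have hM : ∀ j, ∫ ω, |X j ω| ^ 3 ∂P ≤ M := fun j => by
    rw [integral_eq_lintegral_of_nonneg_ae (ae_of_all _ fun ω => by positivity)
      (hmeas3 j).aestronglyMeasurable]
    exact ENNReal.toReal_mono hX3.ne (le_iSup (fun j => ∫⁻ ω, ENNReal.ofReal (|X j ω| ^ 3) ∂P) j)
  have hchar : ∀ t : ℝ, Tendsto (fun p => charFun (μ p : Measure ℝ) t) sparseRange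
      (𝓝 (charFun (ν : Measure ℝ) t)) := by
    intro t
    have h1 := ((tendsto_integral_exp_neg hX hR hlim t).comp tendsto_fst_sparseRange)
    have h2 := (Complex.continuous_ofReal.tendsto _).comp h1
    rw [← charFun_mixedNormal hR t] at h2
    have h3 : Tendsto (fun p : ℕ × ℕ => 21 * |t| ^ 3 * M / √(p.2 : ℝ)
        + 2 * t ^ 2 * ((p.2 : ℝ) / p.1) + |t| * √((p.2 : ℝ) / p.1)) sparseRange (𝓝 0) := by
      have a1 : Tendsto (fun p : ℕ × ℕ => √(p.2 : ℝ)) sparseRange atTop :=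
        Real.tendsto_sqrt_atTop.comp (tendsto_natCast_atTop_atTop.comp tendsto_snd_sparseRange)
      have a2 := tendsto_inv_ratio_sparseRange
      have a3 := (Real.continuous_sqrt.tendsto 0).comp a2
      rw [Real.sqrt_zero] at a3
      have := ((a1.const_div_atTop (21 * |t| ^ 3 * M)).add (a2.const_mul (2 * t ^ 2))).add
        (a3.const_mul |t|)
      simpa using this
    have h4 : Tendsto (fun p : ℕ × ℕ => charFun (μ p : Measure ℝ) t
        - ((∫ ω, Real.exp (-(t ^ 2 / 2 * ((∑ j ∈ Finset.range p.1, X j ω ^ 2) / p.1))) ∂P : ℝ) : ℂ))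
        sparseRange (𝓝 0) := by
      refine squeeze_zero_norm' ?_ h3
      filter_upwards [eventually_sparseRange] with p hp
      have := norm_charFun_bernoulliLaw_sub_le hX hXX hint3 hM hp.1 hp.2 t
      rw [← selectionProb_eq hp.2] at this
      rw [← selectionProb_eq hp.2]
      exact this
    have h5 := h4.add h2
    rw [zero_add] at h5
    refine h5.congr fun p => ?_
    simp only [Function.comp]
    ring
  have hμ : Tendsto μ sparseRange (𝓝 ν) := by
    refine tendsto_of_seq_tendsto fun x hx => ?_
    exact ProbabilityMeasure.tendsto_of_tendsto_charFun fun t => (hchar t).comp hx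
  have h := tendsto_levyDistance hμ
  refine h.congr fun p => ?_
  congr 1
  · funext x
    exact bernoulliLaw_real_Iic (P := P) hX (selectionProb_nonneg p.1 p.2)
      (selectionProb_le_one p.1 p.2) p.1 p.2 x
  · funext x
    change ((P'.prod (gaussianReal 0 1)).map (fun q : Ω' × ℝ => R q.1 * q.2)).real (Set.Iic x) = _
    rw [map_measureReal_apply hm measurableSet_Iic]
    rfl

end Convergence

/-! ### Choice of constants and conclusion. -/

lemma sliceMeasure_mono {n k : ℕ} {A B : Set (Finset ℕ)} (h : A ⊆ B) :
    sliceMeasure n k A ≤ sliceMeasure n k B := by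
  have := sliceMeasure_le_sum (n := n) (k := k) (A := A) (N := 1) (B := fun _ => B)
    fun τ _ hτ => ⟨0, one_pos, h hτ⟩
  rwa [Finset.sum_range_one] at this

lemma exp_one_div_four_pow_le {k : ℕ} (hk : 1 ≤ k) : (Real.exp 1 / 4) ^ k ≤ 5 / 2 / k := by
  have hk0 : (0 : ℝ) < k := by exact_mod_cast hk
  have he := Real.exp_one_lt_d9
  have h1 : Real.exp 1 / 4 ≤ (7 / 5)⁻¹ := by norm_num; linarith
  have h2 := one_add_mul_le_pow (a := (2 / 5 : ℝ)) (by norm_num) k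
  calc (Real.exp 1 / 4) ^ k ≤ ((7 / 5)⁻¹ : ℝ) ^ k := by gcongr
    _ = (((1 : ℝ) + 2 / 5) ^ k)⁻¹ := by rw [inv_pow]; norm_num
    _ ≤ (2 / 5 * (k : ℝ))⁻¹ := by
        refine inv_anti₀ (by positivity) ?_
        linarith
    _ = 5 / 2 / k := by field_simp

theorem theorem5p2 :
    ∃ C c : ℝ, 0 < C ∧ 0 < c ∧
      ∀ (Ω : Type*) [MeasurableSpace Ω] (P : Measure Ω) [IsProbabilityMeasure P]
        (Ω' : Type*) [MeasurableSpace Ω'] (P' : Measure Ω') [IsProbabilityMeasure P']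
        (X : ℕ → Ω → ℝ) (R : Ω' → ℝ),
        (∀ j, Measurable (X j)) →
        (∀ i j, ∫ ω, X i ω * X j ω ∂P = if i = j then 1 else 0) →
        (∀ j, ∫ ω, X j ω ∂P = 0) →
        (⨆ j, ∫⁻ ω, ENNReal.ofReal (|X j ω| ^ 3) ∂P) < ⊤ →
        Measurable R →
        (∀ᵐ ω ∂P', 0 ≤ R ω) →
        TendstoInDistribution
          (fun (n : ℕ) (ω : Ω) => (∑ j ∈ Finset.range n, X j ω ^ 2) / (n : ℝ))
          atTop (fun ω => R ω ^ 2) (fun _ => P) P' →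
        ∃ ε : ℕ → ℕ → ℝ,
          Tendsto (fun p : ℕ × ℕ => ε p.1 p.2) sparseRange (𝓝 0) ∧
          ∀ n k : ℕ, 1 ≤ k → k ≤ n → ∀ δ : ℝ, 0 < δ →
            sliceMeasure n k
                {τ | ¬ levyDistance (distFun P (normalizedSum X τ)) (mixedNormalDistFun P' R)
                      < δ + ε n k}
              ≤ C * (k : ℝ) ^ (3 / 4 : ℝ) * Real.exp (-c * k * δ ^ 8) := by
  -- Concentration is used at `δ / 4`: `1024 = 64 · 4²` and `13631488 = 3328 · 4⁶`.
  refine ⟨1024, 1 / 13631488, by norm_num, by norm_num, ?_⟩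
  intro Ω _ P _ Ω' _ P' _ X R hX hXX _ hX3 hR _ hlim
  refine ⟨fun n k => levyDistance (bernoulliDistFun P X (selectionProb n k) n k)
    (mixedNormalDistFun P' R) + 1 / ((k : ℝ) + 1), ?_, ?_⟩
  · have h1 := tendsto_levyDistance_bernoulliDistFun hX hXX hX3 hR hlim
    have h2 := (tendsto_one_div_add_atTop_nhds_zero_nat (𝕜 := ℝ)).comp tendsto_snd_sparseRange
    have h3 := h1.add h2
    rw [add_zero] at h3
    exact h3
  intro n k hk hkn δ hδ
  have hk1 : (1 : ℝ) ≤ k := by exact_mod_cast hk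
  have hk0 : (0 : ℝ) < k := by linarith
  have hεpos : 0 < 1 / ((k : ℝ) + 1) := by positivity
  have hL0 := levyDistance_nonneg (bernoulliDistFun P X (selectionProb n k) n k)
    (mixedNormalDistFun P' R)
  have hG := bernoulliDistFun_mem_Icc (P := P) (X := X) (selectionProb_nonneg n k)
    (selectionProb_le_one n k) n k
  have hH : ∀ x, mixedNormalDistFun P' R x ∈ Set.Icc (0 : ℝ) 1 := distFun_mem_Icc _ _
  rcases lt_or_ge 1 δ with hδ1 | hδ1
  · rw [sliceMeasure_eq_zero]
    · positivity
    · intro τ _ hτ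
      refine hτ ?_
      have := levyDistance_le_one (distFun_mem_Icc P (normalizedSum X τ)) hH
      linarith
  -- Below the threshold the asserted bound exceeds `1`. Above it `kδ ≥ 20`, just enough for `(5 /
  -- 2) / k ≤ δ / 8`.
  rcases lt_or_ge (k * δ ^ 8) 20 with hsmall | hlarge
  · refine (sliceMeasure_le_one _ _ _).trans ?_
    have h1 : (1 : ℝ) ≤ (k : ℝ) ^ (3 / 4 : ℝ) := Real.one_le_rpow hk1 (by norm_num)
    have h2 : (1 / 1024 : ℝ) ≤ Real.exp (-(1 / 13631488) * k * δ ^ 8) := by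
      have := Real.add_one_le_exp (-(1 / 13631488) * k * δ ^ 8)
      linarith
    have h3 := mul_le_mul h1 h2 (by norm_num) (by positivity)
    linarith
  have hδ4 : 0 < δ / 4 := by positivity
  have hδ8 : δ ^ 8 ≤ δ := pow_le_of_le_one hδ.le hδ1 (by norm_num)
  have hkδ : (Real.exp 1 / 4) ^ k ≤ δ / 4 / 2 := by
    refine (exp_one_div_four_pow_le hk).trans ?_
    rw [div_le_iff₀ hk0]
    nlinarith
  have hmain := sliceMeasure_levy_gt_le (P := P) hX hXX hk hkn hδ4 (by linarith) hkδ
  have hsub : sliceMeasure n k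
      {τ | ¬ levyDistance (distFun P (normalizedSum X τ)) (mixedNormalDistFun P' R)
        < δ + (levyDistance (bernoulliDistFun P X (selectionProb n k) n k)
          (mixedNormalDistFun P' R) + 1 / ((k : ℝ) + 1))}
      ≤ 64 * √k / (δ / 4) ^ 2 * Real.exp (-(k * (δ / 4) ^ 6 / 3328)) := by
    refine le_trans ?_ hmain
    refine sliceMeasure_mono fun τ hτ hgood => hτ ?_
    rw [← selectionProb_eq hkn] at hgood
    have := levyDistance_le_add hG hH (by positivity : 0 ≤ 2 * (δ / 4))
      (fun x => (hgood x).1) fun x => (hgood x).2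
    linarith
  refine hsub.trans ?_
  have hexp : Real.exp (-(k * (δ / 4) ^ 6 / 3328)) ≤ Real.exp (-(1 / 13631488) * k * δ ^ 8) := by
    rw [Real.exp_le_exp]
    have h1 : δ ^ 8 ≤ δ ^ 6 := pow_le_pow_of_le_one hδ.le hδ1 (by norm_num)
    have h2 := mul_le_mul_of_nonneg_left h1 hk0.le
    have e : (k : ℝ) * (δ / 4) ^ 6 / 3328 = 1 / 13631488 * (k * δ ^ 6) := by ring
    rw [e]
    linarith
  -- Source of the exponent `3 / 4`: `kδ⁸ ≥ 1` gives `δ⁻² ≤ k^(1/4)`, which multiplies `√k`.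
  have hpoly : 64 * √k / (δ / 4) ^ 2 ≤ 1024 * (k : ℝ) ^ (3 / 4 : ℝ) := by
    have h1 : (k : ℝ) ^ (3 / 4 : ℝ) = √k * (k : ℝ) ^ (1 / 4 : ℝ) := by
      rw [Real.sqrt_eq_rpow, ← Real.rpow_add hk0]; norm_num
    have h2 : 1 ≤ (k : ℝ) ^ (1 / 4 : ℝ) * δ ^ 2 := by
      have h3 : (1 : ℝ) ≤ (k * δ ^ 8) ^ (1 / 4 : ℝ) :=
        Real.one_le_rpow (by linarith) (by norm_num)
      rw [Real.mul_rpow hk0.le (by positivity), ← Real.rpow_natCast δ 8, ← Real.rpow_mul hδ.le]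
        at h3
      norm_num at h3
      exact h3
    have h4 : 64 * √k / (δ / 4) ^ 2 = 1024 * √k / δ ^ 2 := by field_simp; norm_num
    rw [h4, h1, div_le_iff₀ (by positivity)]
    have h5 := mul_le_mul_of_nonneg_left h2 (by positivity : (0 : ℝ) ≤ 1024 * √k)
    linarith
  exact mul_le_mul hpoly hexp (Real.exp_pos _).le (by positivity)
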